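/- Let $d\ge 1$, $s\in\mathbb{N}_0$ and $k\in\{0,\ldots,d-1\}$. Write $\kappa_n=\pi^{n/2}/\Gamma(1+n/2)$ and $\omega_n=n\kappa_n$. For a nonempty compact convex set $K\subset\mathbb{R}^d$ let $\Lambda_0(K,\cdot),\ldots,\Lambda_{d-1}(K,\cdot)$ be its support measures, i.e. the finite Borel measures on $\mathbb{R}^d\times\mathbb{S}^{d-1}$ determined by the local Steiner formula $$\mathrm{vol}\Bigl(\Bigl\{x:\ 0<\mathrm{dist}(x,K)\le\varepsilon,\ \Bigl(p_K(x),\tfrac{x-p_K(x)}{\mathrm{dist}(x,K)}\Bigr)\in\eta\Bigr\}\Bigr)=\sum_{j=0}^{d-1}\varepsilon^{d-j}\kappa_{d-j}\Lambda_j(K,\eta)$$ for all $\varepsilon>0$ and all Borel sets $\eta$, where $p_K$ is the metric projection onto $K$. Let $V_k(K)=\Lambda_k(K,\mathbb{R}^d\times\mathbb{S}^{d-1})$ be the $k$-th intrinsic volume, and $$\Phi_k^{0,s}(K)=\frac{1}{s!}\frac{\omega_{d-k}}{\omega_{d-k+s}}\int_{\mathbb{R}^d\times\mathbb{S}^{d-1}}u^s\,\Lambda_k(K,\mathrm{d}(x,u)),$$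 a symmetric tensor of rank $s$ on $\mathbb{R}^d$, where $u^s(x_1,\ldots,x_s)=\prod_{i=1}^s\langle u,x_i\rangle$. Let $Q(x,y)=\langle x,y\rangle$ be the metric tensor and, for $m\in\mathbb{N}_0$, let $Q^m$ be its $m$-fold symmetric tensor power, $$Q^m(x_1,\ldots,x_{2m})=\frac{1}{(2m)!}\sum_{\sigma}\prod_{i=1}^m\langle x_{\sigma(2i-1)},x_{\sigma(2i)}\rangle ,$$ where the sum is over all permutations $\sigma$ of $\{1,\ldots,2m\}$. Let $Z$ be an isotropic random polytope in $\mathbb{R}^d$, that is, a random element of the space of nonempty compact subsets of $\mathbb{R}^d$ (with the Borel $\sigma$-algebra of the Hausdorff metric) which is almost surely a polytope and for which $\rho Z$ and $Z$ have the same distribution for all $\rho\in SO(d)$. If $\mathbb{E}V_k(Z)<\infty$, then $\Phi_k^{0,s}(Z)$ is integrable and $$\mathbb{E}\,\Phi_k^{0,s}(Z)=\mathbf{1}\{s\text{ even}\}\,\frac{2\,\omega_{d+s}\,\omega_{d-k}}{s!\,\omega_d\,\omega_{s+1}\,\omega_{d-k+s}}\,\mathbb{E}V_k(Z)\cdot Q^{s/2}.$$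 In particular, if $\mathbb{E}V_{d-1}(Z)<\infty$, the expected surface tensors are $$\mathbb{E}\,\Phi_{d-1}^{0,s}(Z)=\mathbf{1}\{s\text{ even}\}\,\frac{4\,\omega_{d+s}}{s!\,\omega_d\,\omega_{s+1}^2}\,\mathbb{E}V_{d-1}(Z)\cdot Q^{s/2}.$$ -/

import Mathlib

open MeasureTheory ProbabilityTheory TopologicalSpace Topology
open scoped BigOperators ENNReal

noncomputable section

/-! ### Euclidean space, constants -/

/-- The Euclidean space `ℝ^d`. -/
abbrev Euc (d : ℕ) : Type := EuclideanSpace ℝ (Fin d)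

/-- The unit sphere `S^{d-1}` of `ℝ^d`. -/
abbrev USphere (d : ℕ) : Type := Metric.sphere (0 : Euc d) 1

/-- `κ_n = π^{n/2} / Γ(1 + n/2)`, the volume of the unit ball of `ℝ^n`. -/
def kappa (n : ℕ) : ℝ := Real.pi ^ ((n : ℝ) / 2) / Real.Gamma (1 + (n : ℝ) / 2)

/-- `ω_n = n κ_n`, the surface area of the unit sphere of `ℝ^n`. -/
def omegaConst (n : ℕ) : ℝ := n * kappa n

/-! ### Tensors -/

/-- Tensors of rank `r` on `ℝ^d`: `r`-linear maps `(ℝ^d)^r → ℝ` (automatically continuous), with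
the norm `|T| = sup {|T(x₁,…,x_r)| : ‖x_i‖ ≤ 1}`. -/
abbrev Tensor (d r : ℕ) : Type := ContinuousMultilinearMap ℝ (fun _ : Fin r => Euc d) ℝ

/-- The `s`-fold symmetric power `u^s` of a vector `u`, i.e. `(x₁,…,x_s) ↦ ∏ ⟨u, x_i⟩`. -/
def vecPow {d : ℕ} (u : Euc d) (s : ℕ) : Tensor d s :=
  (ContinuousMultilinearMap.mkPiAlgebra ℝ (Fin s) ℝ).compContinuousLinearMap
    (fun _ => innerSL ℝ u)

theorem vecPow_apply {d : ℕ} (u : Euc d) (s : ℕ) (x : Fin s → Euc d) :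
    vecPow u s x = ∏ i, inner ℝ u (x i) := by
  simp [vecPow]

/-- The (unsymmetrized) `m`-fold tensor power
`(x₁,…,x_{mr}) ↦ ∏_{i=1}^m a(x_{(i-1)r+1},…,x_{ir})` of a tensor `a` of rank `r`. -/
def blockPow {d r : ℕ} (a : Tensor d r) (m : ℕ) : Tensor d (m * r) where
  toMultilinearMap :=
    MultilinearMap.domDomCongr ((Equiv.sigmaEquivProd (Fin m) (Fin r)).trans finProdFinEquiv)
      ((MultilinearMap.mkPiAlgebra ℝ (Fin m) ℝ).compMultilinearMap
        (fun _ : Fin m => a.toMultilinearMap))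
  cont := by
    change Continuous fun x : Fin (m * r) → Euc d =>
      (MultilinearMap.mkPiAlgebra ℝ (Fin m) ℝ)
        (fun i : Fin m => a (fun j : Fin r => x (finProdFinEquiv (i, j))))
    simp only [MultilinearMap.mkPiAlgebra_apply]
    exact continuous_finsetProd _ fun i _ =>
      a.cont.comp (continuous_pi fun j => continuous_apply _)

theorem blockPow_apply {d r : ℕ} (a : Tensor d r) (m : ℕ) (x : Fin (m * r) → Euc d) :
    blockPow a m x = ∏ i : Fin m, a (fun j => x (finProdFinEquiv (i, j))) := rfl

/-- The `m`-fold symmetric tensor product `a^m = a ⊙ ⋯ ⊙ a` of a tensor `a` of rank `r`: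
`a^m(x₁,…,x_{mr}) = 1/(mr)! ∑_σ ∏_{i=1}^m a(x_{σ((i-1)r+1)},…,x_{σ(ir)})`. -/
def symPow {d r : ℕ} (a : Tensor d r) (m : ℕ) : Tensor d (m * r) :=
  (1 / ((m * r).factorial : ℝ)) •
    ∑ σ : Equiv.Perm (Fin (m * r)), (blockPow a m).domDomCongr σ

theorem symPow_apply {d r : ℕ} (a : Tensor d r) (m : ℕ) (x : Fin (m * r) → Euc d) :
    symPow a m x = 1 / ((m * r).factorial : ℝ) * ∑ σ : Equiv.Perm (Fin (m * r)),
      ∏ i : Fin m, a (fun j => x (σ (finProdFinEquiv (i, j)))) := by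
  simp [symPow, blockPow_apply]

/-- The metric tensor `Q(x, y) = ⟨x, y⟩`, a tensor of rank two. -/
def metricTensor (d : ℕ) : Tensor d 2 where
  toFun x := inner ℝ (x 0) (x 1)
  map_update_add' x i a b := by
    fin_cases i <;> simp [inner_add_left, inner_add_right]
  map_update_smul' x i c a := by
    fin_cases i <;> simp [inner_smul_left, inner_smul_right]
  cont := (continuous_apply 0).inner (continuous_apply 1)

theorem metricTensor_apply {d : ℕ} (x : Fin 2 → Euc d) :
    metricTensor d x = inner ℝ (x 0) (x 1) := rfl

/-- A tensor of rank `p`, regarded as a tensor of rank `q = p`. -/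
def Tensor.cast {d p q : ℕ} (h : p = q) (T : Tensor d p) : Tensor d q :=
  T.domDomCongr (finCongr h)

/-! ### Support measures, intrinsic volumes, Minkowski tensors -/

/-- The local parallel set `M_ε(K, η)` of a convex body `K`: all points `x` with
`0 < dist(x, K) ≤ ε` for which the pair `(p, u)` consisting of the nearest point `p` of `K` to `x`
and of the unit vector `u = (x - p) / dist(x, K)` belongs to `η`. -/
def localParallelSet {d : ℕ} (K : Set (Euc d)) (ε : ℝ) (η : Set (Euc d × USphere d)) :
    Set (Euc d) :=
  {x | 0 < Metric.infDist x K ∧ Metric.infDist x K ≤ ε ∧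
    ∃ p ∈ K, ∃ u : USphere d, (p, u) ∈ η ∧ x = p + Metric.infDist x K • (u : Euc d)}

/-- The local Steiner formula: `Λ_0, …, Λ_{d-1}` are finite Borel measures on `ℝ^d × S^{d-1}` with
`vol (M_ε(K, η)) = ∑_{j=0}^{d-1} ε^{d-j} κ_{d-j} Λ_j(η)` for all `ε > 0` and all Borel sets `η`. -/
def IsSupportMeasures {d : ℕ} (K : Set (Euc d)) (Λ : Fin d → Measure (Euc d × USphere d)) : Prop :=
  (∀ j, IsFiniteMeasure (Λ j)) ∧
    ∀ ε : ℝ, 0 < ε → ∀ η : Set (Euc d × USphere d), MeasurableSet η →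
      volume (localParallelSet K ε η) =
        ∑ j : Fin d, ENNReal.ofReal (ε ^ (d - (j : ℕ)) * kappa (d - (j : ℕ))) * Λ j η

open Classical in
/-- The support measures `Λ_j(K, ·)`, `j = 0, …, d-1`, of a convex body `K`: the measures
determined by the local Steiner formula. (They exist and are unique for every nonempty compact
convex set `K`; the value for other sets is irrelevant.) -/
def supportMeasure {d : ℕ} (K : Set (Euc d)) (j : Fin d) : Measure (Euc d × USphere d) :=
  if h : ∃ Λ : Fin d → Measure (Euc d × USphere d), IsSupportMeasures K Λ then h.choose j else 0

/-- The intrinsic volume `V_k(K) = Λ_k(K, ℝ^d × S^{d-1})`, `k = 0, …, d-1`, of a convex body. -/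
def intrinsicVolume {d : ℕ} (k : Fin d) (K : Set (Euc d)) : ℝ :=
  (supportMeasure K k).real Set.univ

/-- The Minkowski tensor
`Φ_k^{0,s}(K) = 1/s! · ω_{d-k}/ω_{d-k+s} · ∫ u^s Λ_k(K, d(x,u))`, `k = 0, …, d-1`,
of a convex body `K`. -/
def minkowskiTensor {d : ℕ} (k : Fin d) (s : ℕ) (K : Set (Euc d)) : Tensor d s :=
  (1 / (s.factorial : ℝ) * (omegaConst (d - (k : ℕ)) / omegaConst (d - (k : ℕ) + s))) •
    ∫ y, vecPow (y.2 : Euc d) s ∂(supportMeasure K k)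

/-! ### Isotropic random polytopes -/

/-- A polytope is the convex hull of a finite set of points. -/
def IsPolytope {d : ℕ} (K : Set (Euc d)) : Prop :=
  ∃ F : Finset (Euc d), K = convexHull ℝ (F : Set (Euc d))

/-- The Borel σ-algebra of the Hausdorff metric on the nonempty compact subsets of `ℝ^d`. -/
instance instMeasurableSpaceNonemptyCompactsEuc (d : ℕ) :
    MeasurableSpace (NonemptyCompacts (Euc d)) := borel _

instance instBorelSpaceNonemptyCompactsEuc (d : ℕ) : BorelSpace (NonemptyCompacts (Euc d)) := ⟨rfl⟩

/-- The image `ρ K` of a nonempty compact set `K` under a linear isometry `ρ`. -/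
def rotate {d : ℕ} (ρ : Euc d ≃ₗᵢ[ℝ] Euc d) (K : NonemptyCompacts (Euc d)) :
    NonemptyCompacts (Euc d) :=
  K.map ρ ρ.continuous

/-- `Z` is an isotropic random polytope: a random element of the space of nonempty compact sets
that is almost surely a polytope, such that `ρ Z` and `Z` have the same distribution for every
proper rotation `ρ ∈ SO(d)`. -/
structure IsIsotropicRandomPolytope {d : ℕ} {Ω : Type*} [MeasurableSpace Ω] (P : Measure Ω)
    (Z : Ω → NonemptyCompacts (Euc d)) : Prop where
  measurable : Measurable Z
  polytope : ∀ᵐ ω ∂P, IsPolytope (Z ω : Set (Euc d))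
  isotropic : ∀ ρ : Euc d ≃ₗᵢ[ℝ] Euc d, LinearMap.det (ρ : Euc d →ₗ[ℝ] Euc d) = 1 →
    IdentDistrib (fun ω => rotate ρ (Z ω)) Z P P

end

/-! The expectation T of the Minkowski tensor is a symmetric tensor, and isotropy makes it rotation
invariant. Hence x ↦ T(x,…,x) is constant on the unit sphere, so it equals c‖x‖^s by homogeneity. A
symmetric tensor is determined by its diagonal (`Tensor.ext_of_diagonal`). For odd s, comparing x
with -x gives c = 0; for even s, ‖x‖^s is the diagonal of Q^{s/2}, so T = c Q^{s/2}.

The constant c comes from integrating the diagonal against exp(-‖x‖²). On c‖x‖^s this is a radial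
integral. On u^s with ‖u‖ = 1 the value does not depend on u, so the functional sends Φ_k^{0,s}(K)
to an explicit multiple of V_k(K). Comparing the two values after taking expectations gives c.

In dimension one SO(1) is trivial and isotropy carries no information. There a polytope is a
segment, symmetric about its midpoint, and translation invariance of the tensors gives the missing
invariance under x ↦ -x.

Most of the work makes these expectations meaningful, since support measures are only chosen from
their defining property. Existence for polytopes: cut the polytope into pieces, each lying in an
affine subspace to which all its normals are orthogonal; stretching the normal directions by ε shows
that the parallel volume over a piece with direction space W is proportional to ε^{d - dim W}.
Measurability and invariance: inverting a Vandermonde system writes Λ_k through the parallel volumes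
of radii 1,…,d, and the normal u is the gradient of the distance to K. Moments of Λ_k thereby become
integrals built from the distance function alone (`shellMoment`), which are Borel in K and
compatible with isometries. -/

noncomputable section

/-! ### Normal pairs of convex bodies -/

/-- `(p, u)` is a normal pair of `K`: `p ∈ K` and `u` is an outer unit normal vector of `K`
at `p`. -/
def IsNormalPair {d : ℕ} (K : Set (Euc d)) (y : Euc d × USphere d) : Prop :=
  y.1 ∈ K ∧ ∀ q ∈ K, inner ℝ (y.2 : Euc d) (q - y.1) ≤ 0

section NormalPairs

variable {d : ℕ} {K : Set (Euc d)}

theorem USphere.norm_eq (u : USphere d) : ‖(u : Euc d)‖ = 1 := by simp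

/-- K lies in its supporting half-space at y, and the distance to K is at least the signed distance
to the bounding hyperplane. -/
theorem IsNormalPair.inner_le_infDist {y : Euc d × USphere d} (hy : IsNormalPair K y) (x : Euc d) :
    inner ℝ (y.2 : Euc d) (x - y.1) ≤ Metric.infDist x K := by
  refine (Metric.le_infDist ⟨_, hy.1⟩).2 fun q hq => ?_
  have h1 := hy.2 q hq
  have h2 : inner ℝ (y.2 : Euc d) (x - q) ≤ 1 * ‖x - q‖ := by
    have := real_inner_le_norm (y.2 : Euc d) (x - q)
    rwa [USphere.norm_eq] at this
  have h3 : x - y.1 = (x - q) + (q - y.1) := by abel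
  rw [h3, inner_add_right, dist_eq_norm]
  linarith

theorem IsNormalPair.infDist_add {y : Euc d × USphere d} (hy : IsNormalPair K y) {r : ℝ}
    (hr : 0 ≤ r) : Metric.infDist (y.1 + r • (y.2 : Euc d)) K = r := by
  apply le_antisymm
  · refine (Metric.infDist_le_dist_of_mem hy.1).trans ?_
    rw [dist_eq_norm, add_sub_cancel_left, norm_smul, USphere.norm_eq, Real.norm_of_nonneg hr,
      mul_one]
  · have := hy.inner_le_infDist (y.1 + r • (y.2 : Euc d))
    rwa [add_sub_cancel_left, inner_smul_right, real_inner_self_eq_norm_sq, USphere.norm_eq,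
      one_pow, mul_one] at this

/-- This is the variational inequality characterizing nearest points in a convex set. -/
theorem isNormalPair_of_eq_add (hc : Convex ℝ K) {x : Euc d}
    (hx : 0 < Metric.infDist x K) {y : Euc d × USphere d} (hy : y.1 ∈ K)
    (hxy : x = y.1 + Metric.infDist x K • (y.2 : Euc d)) : IsNormalPair K y := by
  refine ⟨hy, fun q hq => ?_⟩
  set r := Metric.infDist x K with hr
  have hxy' : x - y.1 = r • (y.2 : Euc d) := by rw [sub_eq_iff_eq_add', ← hxy]
  have hn : ‖x - y.1‖ = r := by
    rw [hxy', norm_smul, USphere.norm_eq, mul_one, Real.norm_of_nonneg hx.le]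
  have : Nonempty K := ⟨⟨_, hy⟩⟩
  have hmin : ‖x - y.1‖ = ⨅ w : K, ‖x - w‖ := by
    rw [hn, hr, Metric.infDist_eq_iInf]
    simp only [dist_eq_norm]
  have := (norm_eq_iInf_iff_real_inner_le_zero hc hy).1 hmin q hq
  rw [hxy', inner_smul_left] at this
  simp only [conj_trivial] at this
  nlinarith

theorem exists_isNormalPair (hK : IsCompact K) (hne : K.Nonempty) (hc : Convex ℝ K) {x : Euc d}
    (hx : 0 < Metric.infDist x K) :
    ∃ y : Euc d × USphere d, IsNormalPair K y ∧ x = y.1 + Metric.infDist x K • (y.2 : Euc d) := by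
  obtain ⟨p, hp, hpd⟩ := hK.exists_infDist_eq_dist hne x
  have hn : ‖x - p‖ = Metric.infDist x K := by rw [hpd, dist_eq_norm]
  have hu : (Metric.infDist x K)⁻¹ • (x - p) ∈ Metric.sphere (0 : Euc d) 1 := by
    rw [mem_sphere_zero_iff_norm, norm_smul, hn, norm_inv, Real.norm_of_nonneg hx.le,
      inv_mul_cancel₀ hx.ne']
  have hxy : x = p + Metric.infDist x K • ((Metric.infDist x K)⁻¹ • (x - p)) := by
    rw [smul_inv_smul₀ hx.ne']; abel
  exact ⟨(p, ⟨_, hu⟩), isNormalPair_of_eq_add hc hx hp hxy, hxy⟩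

/-- Monotonicity of the normal cone, ⟨r u - r' u', p - p'⟩ ≥ 0, followed by Cauchy–Schwarz. It says
that the metric projection is 1-Lipschitz, and it also yields uniqueness of normal pairs. -/
theorem IsNormalPair.dist_fst_le {y y' : Euc d × USphere d} (hy : IsNormalPair K y)
    (hy' : IsNormalPair K y') {r r' : ℝ} (hr : 0 ≤ r) (hr' : 0 ≤ r') :
    dist y.1 y'.1 ≤ dist (y.1 + r • (y.2 : Euc d)) (y'.1 + r' • (y'.2 : Euc d)) := by
  have h1 := mul_nonpos_of_nonneg_of_nonpos hr (hy.2 _ hy'.1)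
  have h2 := mul_nonpos_of_nonneg_of_nonpos hr' (hy'.2 _ hy.1)
  rw [dist_eq_norm, dist_eq_norm]
  obtain ⟨w, hw⟩ : ∃ w, w = y.1 - y'.1 := ⟨_, rfl⟩
  rw [← hw] at h2 ⊢
  have h3 : ‖w‖ ^ 2 ≤ inner ℝ (y.1 + r • (y.2 : Euc d) - (y'.1 + r' • (y'.2 : Euc d))) w := by
    have e : y.1 + r • (y.2 : Euc d) - (y'.1 + r' • (y'.2 : Euc d))
        = w + (r • (y.2 : Euc d) - r' • (y'.2 : Euc d)) := by rw [hw]; abel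
    have e2 : y'.1 - y.1 = -w := by rw [hw]; abel
    rw [e2, inner_neg_right] at h1
    rw [e, inner_add_left, inner_sub_left, inner_smul_left, inner_smul_left,
      real_inner_self_eq_norm_sq]
    simp only [conj_trivial]
    linarith
  have h4 := h3.trans (real_inner_le_norm _ _)
  rcases (norm_nonneg w).eq_or_lt with h | h
  · rw [← h]; positivity
  · nlinarith

theorem IsNormalPair.eq_of_add_eq {y y' : Euc d × USphere d} (hy : IsNormalPair K y)
    (hy' : IsNormalPair K y') {r : ℝ} (hr : 0 < r)
    (h : y.1 + r • (y.2 : Euc d) = y'.1 + r • (y'.2 : Euc d)) : y = y' := by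
  have h1 : y.1 = y'.1 := dist_le_zero.1 ((hy.dist_fst_le hy' hr.le hr.le).trans (by rw [h, dist_self]))
  rw [h1, add_right_inj] at h
  exact Prod.ext h1 (Subtype.ext (smul_right_injective _ hr.ne' h))

/-- The gradient of the distance to K at p + r u is u. The distance is squeezed between the linear
function of the supporting half-space and the distance to the single point p; both have slope ⟨u, v⟩
in direction v. Countably many step sizes are used so that the limit is visibly measurable in K. -/
theorem inner_normal_eq_of_tendsto {y : Euc d × USphere d} (hy : IsNormalPair K y) {r : ℝ}
    (hr : 0 < r) (v : Euc d) :
    Filter.Tendsto (fun n : ℕ => ((n : ℝ) + 1) *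
      (Metric.infDist (y.1 + r • (y.2 : Euc d) + ((n : ℝ) + 1)⁻¹ • v) K
        - Metric.infDist (y.1 + r • (y.2 : Euc d)) K))
      Filter.atTop (𝓝 (inner ℝ (y.2 : Euc d) v)) := by
  set u : Euc d := y.2.1
  have hu : ‖u‖ = 1 := USphere.norm_eq _
  rw [hy.infDist_add hr.le]
  have hub : Filter.Tendsto (fun n : ℕ => ((n : ℝ) + 1) *
      (‖r • u + ((n : ℝ) + 1)⁻¹ • v‖ - r)) Filter.atTop (𝓝 (inner ℝ u v)) := by
    have hne : r • u ≠ 0 := by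
      rw [smul_ne_zero_iff]; exact ⟨hr.ne', by rintro h; simp [h] at hu⟩
    have hd : HasDerivAt (fun t : ℝ => ‖r • u + t • v‖) (inner ℝ u v) 0 := by
      have h1 : HasDerivAt (fun t : ℝ => r • u + t • v) v 0 := by
        simpa using ((hasDerivAt_id (0 : ℝ)).smul_const v).const_add (r • u)
      have h2 := h1.norm_sq
      have h3 := h2.sqrt (by simpa using hne)
      simp only [Real.sqrt_sq (norm_nonneg _)] at h3
      convert h3 using 1
      simp only [zero_smul, add_zero, norm_smul, hu, inner_smul_left, Real.norm_of_nonneg hr.le,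
        conj_trivial]
      field_simp
    have := hd.tendsto_slope_zero_right
    have hs : Filter.Tendsto (fun n : ℕ => ((n : ℝ) + 1)⁻¹) Filter.atTop (𝓝[>] 0) := by
      refine tendsto_nhdsWithin_iff.2 ⟨?_, Filter.Eventually.of_forall fun n => ?_⟩
      · simpa using tendsto_one_div_add_atTop_nhds_zero_nat (𝕜 := ℝ)
      · change (0 : ℝ) < ((n : ℝ) + 1)⁻¹
        positivity
    refine (this.comp hs).congr fun n => ?_
    simp [norm_smul, hu, abs_of_pos hr]
  refine tendsto_of_tendsto_of_tendsto_of_le_of_le tendsto_const_nhds hub (fun n => ?_)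
    (fun n => ?_)
  · have h1 := hy.inner_le_infDist (y.1 + r • u + ((n : ℝ) + 1)⁻¹ • v)
    rw [add_assoc, add_sub_cancel_left, inner_add_right, inner_smul_right, inner_smul_right] at h1
    have h2 : inner ℝ (y.2 : Euc d) u = 1 := by
      rw [real_inner_self_eq_norm_sq, USphere.norm_eq, one_pow]
    rw [h2, mul_one, ← add_assoc] at h1
    have hn : (0 : ℝ) < (n : ℝ) + 1 := by positivity
    calc inner ℝ u v = ((n : ℝ) + 1) * (((n : ℝ) + 1)⁻¹ * inner ℝ u v) := by
          field_simp
      _ ≤ _ := by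
          apply mul_le_mul_of_nonneg_left _ hn.le
          linarith
  · apply mul_le_mul_of_nonneg_left _ (by positivity)
    have := Metric.infDist_le_dist_of_mem (x := y.1 + r • u + ((n : ℝ) + 1)⁻¹ • v) hy.1
    rw [dist_eq_norm, add_assoc, add_sub_cancel_left, ← add_assoc] at this
    linarith

/-! ### The Gauss map of a convex body and its local parallel volumes -/

open Classical in
/-- The map sending a point `x` outside `K` to the pair of its nearest point in `K` and the
direction in which `x` is seen from there. -/
def normalPairAt [Nonempty (USphere d)] (K : Set (Euc d)) (x : Euc d) : Euc d × USphere d :=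
  if h : ∃ y : Euc d × USphere d, 0 < Metric.infDist x K ∧ y.1 ∈ K ∧
      x = y.1 + Metric.infDist x K • (y.2 : Euc d) then h.choose
  else (0, Classical.arbitrary _)

/-- The volume of the local parallel sets of `K` as a measure. -/
def parallelMeasure [Nonempty (USphere d)] (K : Set (Euc d)) (ε : ℝ) :
    Measure (Euc d × USphere d) :=
  (volume.restrict {x | 0 < Metric.infDist x K ∧ Metric.infDist x K ≤ ε}).map (normalPairAt K)

theorem measurableSet_parallel (K : Set (Euc d)) (ε : ℝ) :
    MeasurableSet {x : Euc d | 0 < Metric.infDist x K ∧ Metric.infDist x K ≤ ε} := by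
  have hcd : Measurable fun x : Euc d => Metric.infDist x K :=
    (Metric.continuous_infDist_pt K).measurable
  exact (measurableSet_lt measurable_const hcd).inter (measurableSet_le hcd measurable_const)

theorem volume_parallel_lt_top (hK : IsCompact K) (hne : K.Nonempty) (ε : ℝ) :
    volume {x : Euc d | 0 < Metric.infDist x K ∧ Metric.infDist x K ≤ ε} < ∞ := by
  refine (measure_mono ?_).trans_lt (hK.cthickening (r := ε)).measure_lt_top
  rintro x ⟨h0, hx⟩
  rw [Metric.mem_cthickening_iff,
    ENNReal.le_ofReal_iff_toReal_le (Metric.infEDist_ne_top hne) (h0.le.trans hx)]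
  exact hx

variable [Nonempty (USphere d)]

theorem normalPairAt_spec (hK : IsCompact K) (hne : K.Nonempty) (hc : Convex ℝ K) {x : Euc d}
    (hx : 0 < Metric.infDist x K) :
    IsNormalPair K (normalPairAt K x) ∧
      x = (normalPairAt K x).1 + Metric.infDist x K • ((normalPairAt K x).2 : Euc d) := by
  obtain ⟨y, hy, hxy⟩ := exists_isNormalPair hK hne hc hx
  have h : ∃ y : Euc d × USphere d, 0 < Metric.infDist x K ∧ y.1 ∈ K ∧
      x = y.1 + Metric.infDist x K • (y.2 : Euc d) := ⟨y, hx, hy.1, hxy⟩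
  rw [normalPairAt, dif_pos h]
  have := h.choose_spec
  exact ⟨isNormalPair_of_eq_add hc hx this.2.1 this.2.2, this.2.2⟩

theorem normalPairAt_eq (hK : IsCompact K) (hc : Convex ℝ K) {x : Euc d}
    (hx : 0 < Metric.infDist x K) {y : Euc d × USphere d} (hy : y.1 ∈ K)
    (hxy : x = y.1 + Metric.infDist x K • (y.2 : Euc d)) : normalPairAt K x = y := by
  have h := normalPairAt_spec hK ⟨_, hy⟩ hc hx
  exact h.1.eq_of_add_eq (isNormalPair_of_eq_add hc hx hy hxy) hx (h.2.symm.trans hxy)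

theorem localParallelSet_eq (hK : IsCompact K) (hne : K.Nonempty) (hc : Convex ℝ K) (ε : ℝ)
    (η : Set (Euc d × USphere d)) :
    localParallelSet K ε η =
      normalPairAt K ⁻¹' η ∩ {x | 0 < Metric.infDist x K ∧ Metric.infDist x K ≤ ε} := by
  ext x
  constructor
  · rintro ⟨h1, h2, p, hp, u, hη, hx⟩
    refine ⟨?_, h1, h2⟩
    rw [Set.mem_preimage, normalPairAt_eq (y := (p, u)) hK hc h1 hp hx]
    exact hη
  · rintro ⟨hη, h1, h2⟩
    have h := normalPairAt_spec hK hne hc h1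
    exact ⟨h1, h2, _, h.1.1, _, hη, h.2⟩

/-- Off K both components are continuous, the nearest point being 1-Lipschitz; where the distance is
not positive the map takes its constant default value. -/
theorem measurable_normalPairAt (hK : IsCompact K) (hne : K.Nonempty) (hc : Convex ℝ K) :
    Measurable (normalPairAt K) := by
  have hcd : Continuous fun x : Euc d => Metric.infDist x K := Metric.continuous_infDist_pt K
  have hs : MeasurableSet {x : Euc d | 0 < Metric.infDist x K} :=
    (isOpen_lt continuous_const hcd).measurableSet
  have h1 : ContinuousOn (fun x => (normalPairAt K x).1) {x : Euc d | 0 < Metric.infDist x K} := by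
    have : LipschitzOnWith 1 (fun x => (normalPairAt K x).1)
        {x : Euc d | 0 < Metric.infDist x K} := by
      refine LipschitzOnWith.of_dist_le_mul fun x hx x' hx' => ?_
      have h := normalPairAt_spec hK hne hc hx
      have h' := normalPairAt_spec hK hne hc hx'
      have := h.1.dist_fst_le h'.1 (le_of_lt hx) (le_of_lt hx')
      rw [← h.2, ← h'.2] at this
      simpa using this
    exact this.continuousOn
  have h2 : ContinuousOn (fun x => (normalPairAt K x).2) {x : Euc d | 0 < Metric.infDist x K} := by
    rw [Topology.IsInducing.subtypeVal.continuousOn_iff]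
    have : ContinuousOn (fun x => (Metric.infDist x K)⁻¹ • (x - (normalPairAt K x).1))
        {x : Euc d | 0 < Metric.infDist x K} :=
      (hcd.continuousOn.inv₀ fun x hx => ne_of_gt hx).smul (continuousOn_id.sub h1)
    refine this.congr fun x hx => ?_
    have h := (normalPairAt_spec hK hne hc hx).2
    change ((normalPairAt K x).2 : Euc d) = _
    rw [eq_inv_smul_iff₀ (ne_of_gt hx), eq_sub_iff_add_eq', ← h]
  have h3 : ContinuousOn (normalPairAt K) {x : Euc d | 0 < Metric.infDist x K} := h1.prodMk h2
  classical
  have h4 : normalPairAt K = Set.piecewise {x : Euc d | 0 < Metric.infDist x K} (normalPairAt K)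
      (fun _ => (0, Classical.arbitrary _)) := by
    ext1 x
    by_cases hx : 0 < Metric.infDist x K
    · rw [Set.piecewise_eq_of_mem _ _ _ (by exact hx)]
    · rw [Set.piecewise_eq_of_notMem _ _ _ (by exact hx), normalPairAt, dif_neg]
      rintro ⟨y, h, -⟩
      exact hx h
  rw [h4]
  exact h3.measurable_piecewise continuousOn_const hs

theorem parallelMeasure_apply (hK : IsCompact K) (hne : K.Nonempty) (hc : Convex ℝ K) (ε : ℝ)
    {η : Set (Euc d × USphere d)} (hη : MeasurableSet η) :
    parallelMeasure K ε η = volume (localParallelSet K ε η) := by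
  have hm := measurable_normalPairAt hK hne hc
  rw [parallelMeasure, Measure.map_apply hm hη, Measure.restrict_apply (hm hη),
    localParallelSet_eq hK hne hc]

theorem isFiniteMeasure_parallelMeasure (hK : IsCompact K) (hne : K.Nonempty) (ε : ℝ) :
    IsFiniteMeasure (parallelMeasure K ε) := by
  have : IsFiniteMeasure (volume.restrict
      {x : Euc d | 0 < Metric.infDist x K ∧ Metric.infDist x K ≤ ε}) :=
    ⟨by simpa using volume_parallel_lt_top hK hne ε⟩
  unfold parallelMeasure
  infer_instance

end NormalPairs

/-! ### Existence of the support measures of polytopes -/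

section Polytopes

variable {d : ℕ} {K : Set (Euc d)}

/-- Polar description by a normal pair and a radius, free of the distance function; it makes the
effect of stretching normal directions transparent. -/
theorem mem_localParallelSet_iff (hc : Convex ℝ K) {ε : ℝ} {η : Set (Euc d × USphere d)}
    {x : Euc d} : x ∈ localParallelSet K ε η ↔
      ∃ y ∈ η, IsNormalPair K y ∧ ∃ r : ℝ, 0 < r ∧ r ≤ ε ∧ x = y.1 + r • (y.2 : Euc d) := by
  constructor
  · rintro ⟨h1, h2, p, hp, u, hη, hx⟩
    exact ⟨(p, u), hη, isNormalPair_of_eq_add hc h1 hp hx, _, h1, h2, hx⟩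
  · rintro ⟨y, hy, hn, r, h1, h2, rfl⟩
    refine ⟨?_, ?_, y.1, hn.1, y.2, hy, ?_⟩ <;> rw [hn.infDist_add h1.le]
    exacts [h1, h2]

/-- The linear map that is the identity on `W` and the multiplication by `t` on its orthogonal
complement. -/
def scaleOrthogonal (W : Submodule ℝ (Euc d)) (t : ℝ) : Euc d →ₗ[ℝ] Euc d :=
  t • LinearMap.id + (1 - t) • (W.starProjection : Euc d →ₗ[ℝ] Euc d)

theorem scaleOrthogonal_apply_of_mem {W : Submodule ℝ (Euc d)} (t : ℝ) {w : Euc d} (hw : w ∈ W) :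
    scaleOrthogonal W t w = w := by
  have : W.starProjection w = w := Submodule.starProjection_eq_self_iff.2 hw
  simp only [scaleOrthogonal, LinearMap.add_apply, LinearMap.smul_apply, LinearMap.id_apply,
    ContinuousLinearMap.coe_coe, this]
  module

theorem scaleOrthogonal_apply_of_mem_orthogonal {W : Submodule ℝ (Euc d)} (t : ℝ) {w : Euc d}
    (hw : w ∈ Wᗮ) : scaleOrthogonal W t w = t • w := by
  have : W.starProjection w = 0 := (Submodule.starProjection_apply_eq_zero_iff W).2 hw
  simp [scaleOrthogonal, this]

/-- The map preserves W, acting as the identity on W and as multiplication by t on the quotient. -/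
theorem det_scaleOrthogonal (W : Submodule ℝ (Euc d)) (t : ℝ) :
    LinearMap.det (scaleOrthogonal W t) = t ^ (d - Module.finrank ℝ W) := by
  have he : W ≤ W.comap (scaleOrthogonal W t) := fun w hw => by
    rw [Submodule.mem_comap, scaleOrthogonal_apply_of_mem t hw]; exact hw
  rw [LinearMap.det_eq_det_mul_det W _ he]
  have h1 : (scaleOrthogonal W t).restrict he = LinearMap.id := by
    ext w
    simp [scaleOrthogonal_apply_of_mem t w.2]
  have h2 : W.mapQ W (scaleOrthogonal W t) he = t • LinearMap.id := by
    ext x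
    simp only [LinearMap.comp_apply, Submodule.mkQ_apply, Submodule.mapQ_apply,
      LinearMap.smul_apply, LinearMap.id_apply]
    rw [← Submodule.Quotient.mk_smul, Submodule.Quotient.eq]
    have : scaleOrthogonal W t x - t • x = (1 - t) • W.starProjection x := by
      simp [scaleOrthogonal]
    rw [this]
    exact W.smul_mem _ (W.starProjection_apply_mem x)
  rw [h1, h2, LinearMap.det_id, one_mul, LinearMap.det_smul, LinearMap.det_id, mul_one]
  congr 1
  have := W.finrank_quotient_add_finrank
  simp only [finrank_euclideanSpace, Fintype.card_fin] at this
  omega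

/-- The affine map fixing p₀ + W pointwise and stretching Wᗮ by ε sends p + r u to p + (ε r) u for
every normal pair over C. It therefore carries the parallel set of radius 1 onto that of radius ε,
and its determinant is the power of ε. -/
theorem volume_localParallelSet_eq_pow_mul (hc : Convex ℝ K) {C : Set (Euc d)}
    {W : Submodule ℝ (Euc d)} (hC : ∀ p ∈ C, ∀ q ∈ C, p - q ∈ W)
    (hW : ∀ y, IsNormalPair K y → y.1 ∈ C → (y.2 : Euc d) ∈ Wᗮ) {η : Set (Euc d × USphere d)}
    (hη : ∀ y ∈ η, y.1 ∈ C) {ε : ℝ} (hε : 0 < ε) :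
    volume (localParallelSet K ε η) =
      ENNReal.ofReal (ε ^ (d - Module.finrank ℝ W)) * volume (localParallelSet K 1 η) := by
  rcases C.eq_empty_or_nonempty with rfl | ⟨p₀, hp₀⟩
  · have : η = ∅ := Set.eq_empty_of_forall_notMem fun y hy => hη y hy
    simp [this, localParallelSet]
  have himg : ∀ y ∈ η, IsNormalPair K y → ∀ r : ℝ,
      (p₀ - scaleOrthogonal W ε p₀) + scaleOrthogonal W ε (y.1 + r • (y.2 : Euc d)) =
        y.1 + (ε * r) • (y.2 : Euc d) := fun y hy hn r => by
    have e : (p₀ - scaleOrthogonal W ε p₀) + scaleOrthogonal W ε (y.1 + r • (y.2 : Euc d)) =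
        p₀ + scaleOrthogonal W ε (y.1 - p₀) + r • scaleOrthogonal W ε (y.2 : Euc d) := by
      rw [map_add, map_sub, map_smul]; abel
    rw [e, scaleOrthogonal_apply_of_mem ε (hC _ (hη y hy) _ hp₀),
      scaleOrthogonal_apply_of_mem_orthogonal ε (hW y hn (hη y hy)), smul_smul, mul_comm r]
    abel
  have hset : localParallelSet K ε η =
      (fun x => (p₀ - scaleOrthogonal W ε p₀) + x) ''
        (scaleOrthogonal W ε '' localParallelSet K 1 η) := by
    ext x
    rw [Set.image_image, Set.mem_image, mem_localParallelSet_iff hc]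
    constructor
    · rintro ⟨y, hy, hn, r, hr, hrε, rfl⟩
      refine ⟨y.1 + (r / ε) • (y.2 : Euc d), (mem_localParallelSet_iff hc).2
        ⟨y, hy, hn, r / ε, div_pos hr hε, (div_le_one hε).2 hrε, rfl⟩, ?_⟩
      rw [himg y hy hn, mul_div_cancel₀ _ hε.ne']
    · rintro ⟨z, hz, rfl⟩
      obtain ⟨y, hy, hn, r, hr, hr1, rfl⟩ := (mem_localParallelSet_iff hc).1 hz
      exact ⟨y, hy, hn, ε * r, mul_pos hε hr, mul_le_of_le_one_right hε.le hr1, himg y hy hn r⟩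
  rw [hset, Set.image_add_left, measure_preimage_add, Measure.addHaar_image_linearMap,
    det_scaleOrthogonal, abs_of_pos (pow_pos hε _)]

/-- The convex hull of `S` without the convex hulls of the proper subsets of `S`. -/
def openHull (S : Finset (Euc d)) : Set (Euc d) :=
  convexHull ℝ (S : Set (Euc d)) \ ⋃ T ∈ S.ssubsets, convexHull ℝ (T : Set (Euc d))

theorem measurableSet_openHull (S : Finset (Euc d)) : MeasurableSet (openHull S) := by
  have h : ∀ T : Finset (Euc d), MeasurableSet (convexHull ℝ (T : Set (Euc d))) := fun T =>
    (T.finite_toSet.isCompact_convexHull (𝕜 := ℝ)).isClosed.measurableSet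
  exact (h S).diff (Finset.measurableSet_biUnion _ fun T _ => h T)

theorem exists_mem_openHull {F : Finset (Euc d)} {p : Euc d}
    (hp : p ∈ convexHull ℝ (F : Set (Euc d))) : ∃ S ⊆ F, p ∈ openHull S := by
  induction F using Finset.strongInduction with
  | H F ih =>
    by_cases h : p ∈ ⋃ T ∈ F.ssubsets, convexHull ℝ (T : Set (Euc d))
    · simp only [Set.mem_iUnion, exists_prop, Finset.mem_ssubsets] at h
      obtain ⟨T, hT, hpT⟩ := h
      obtain ⟨S, hS, hpS⟩ := ih T hT hpT
      exact ⟨S, hS.trans hT.subset, hpS⟩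
    · exact ⟨F, Finset.Subset.refl _, hp, h⟩

theorem sub_mem_vectorSpan_of_mem_openHull {S : Finset (Euc d)} {p q : Euc d}
    (hp : p ∈ openHull S) (hq : q ∈ openHull S) : p - q ∈ vectorSpan ℝ (S : Set (Euc d)) := by
  rw [← direction_affineSpan]
  exact AffineSubspace.vsub_mem_direction (convexHull_subset_affineSpan _ hp.1)
    (convexHull_subset_affineSpan _ hq.1)

/-- A point with a vanishing weight could be written with one vertex fewer and would lie in the hull
of a proper subset. -/
theorem exists_pos_weights_of_mem_openHull {S : Finset (Euc d)} {p : Euc d}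
    (hp : p ∈ openHull S) :
    ∃ w : Euc d → ℝ, (∀ v ∈ S, 0 < w v) ∧ ∑ v ∈ S, w v = 1 ∧ ∑ v ∈ S, w v • v = p := by
  classical
  obtain ⟨w, hw0, hw1, hwp⟩ := Finset.mem_convexHull'.1 hp.1
  refine ⟨w, fun v hv => (hw0 v hv).lt_of_ne fun h0 => hp.2 ?_, hw1, hwp⟩
  simp only [Set.mem_iUnion, exists_prop, Finset.mem_ssubsets]
  refine ⟨S.erase v, Finset.erase_ssubset hv, Finset.mem_convexHull'.2
    ⟨w, fun y hy => hw0 y (Finset.mem_of_mem_erase hy), ?_, ?_⟩⟩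
  · rw [Finset.sum_erase _ h0.symm, hw1]
  · rw [Finset.sum_erase _ (by rw [← h0, zero_smul]), hwp]

/-- The numbers ⟨u, v - p⟩ for v in S are nonpositive, yet their combination with positive weights
is ⟨u, 0⟩ = 0; hence each vanishes. -/
theorem IsNormalPair.mem_orthogonal_vectorSpan {F S : Finset (Euc d)} (hS : S ⊆ F)
    {y : Euc d × USphere d} (hy : IsNormalPair (convexHull ℝ (F : Set (Euc d))) y)
    (hp : y.1 ∈ openHull S) : (y.2 : Euc d) ∈ (vectorSpan ℝ (S : Set (Euc d)))ᗮ := by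
  obtain ⟨w, hw0, hw1, hwp⟩ := exists_pos_weights_of_mem_openHull hp
  have hle : ∀ v ∈ S, inner ℝ (y.2 : Euc d) (v - y.1) ≤ 0 := fun v hv =>
    hy.2 v (subset_convexHull ℝ _ (hS hv))
  have hsum : ∑ v ∈ S, w v * inner ℝ (y.2 : Euc d) (v - y.1) = 0 := by
    have : ∑ v ∈ S, w v • (v - y.1) = 0 := by
      simp only [smul_sub, Finset.sum_sub_distrib, hwp, ← Finset.sum_smul, hw1, one_smul, sub_self]
    have h := congrArg (inner ℝ (y.2 : Euc d)) this
    simpa [inner_sum, inner_smul_right] using h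
  have hzero : ∀ v ∈ S, inner ℝ (y.2 : Euc d) (v - y.1) = 0 := fun v hv => by
    have := (Finset.sum_eq_zero_iff_of_nonpos fun v hv =>
      mul_nonpos_of_nonneg_of_nonpos (hw0 v hv).le (hle v hv)).1 hsum v hv
    exact (mul_eq_zero.1 this).resolve_left (hw0 v hv).ne'
  rw [vectorSpan_def, Submodule.mem_orthogonal']
  intro z hz
  induction hz using Submodule.span_induction with
  | mem z hz =>
    obtain ⟨a, ha, b, hb, rfl⟩ := hz
    have : a -ᵥ b = (a - y.1) - (b - y.1) := by simp
    change inner ℝ (y.2 : Euc d) (a -ᵥ b) = 0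
    rw [this, inner_sub_right, hzero a ha, hzero b hb, sub_zero]
  | zero => exact inner_zero_right _
  | add a b _ _ ha hb => rw [inner_add_right, ha, hb, add_zero]
  | smul c a _ ha => rw [inner_smul_right, ha, mul_zero]

/-- A polytope is covered by finitely many disjoint measurable sets, each lying in an affine
subspace to which all normals at its points are orthogonal. -/
theorem exists_face_partition (F : Finset (Euc d)) :
    ∃ (N : ℕ) (C : Fin N → Set (Euc d)) (W : Fin N → Submodule ℝ (Euc d)),
      (∀ i, MeasurableSet (C i)) ∧ Pairwise (Function.onFun Disjoint C) ∧
      convexHull ℝ (F : Set (Euc d)) ⊆ ⋃ i, C i ∧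
      (∀ i, ∀ p ∈ C i, ∀ q ∈ C i, p - q ∈ W i) ∧
      ∀ i y, IsNormalPair (convexHull ℝ (F : Set (Euc d))) y → y.1 ∈ C i →
        (y.2 : Euc d) ∈ (W i)ᗮ := by
  let e := F.powerset.equivFin
  let B : Fin F.powerset.card → Set (Euc d) := fun i => openHull (e.symm i : Finset (Euc d))
  -- Open hulls of different subsets may overlap when F is affinely dependent. Disjointification
  -- only shrinks the pieces, and the two orthogonality properties pass to subsets.
  have hsub : ∀ i, disjointed B i ⊆ openHull (e.symm i : Finset (Euc d)) := fun i =>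
    disjointed_subset B i
  refine ⟨_, disjointed B, fun i => vectorSpan ℝ ((e.symm i : Finset (Euc d)) : Set (Euc d)),
    fun i => ?_, disjoint_disjointed B, ?_, fun i p hp q hq =>
      sub_mem_vectorSpan_of_mem_openHull (hsub i hp) (hsub i hq), fun i y hy hp =>
      hy.mem_orthogonal_vectorSpan (Finset.mem_powerset.1 (e.symm i).2) (hsub i hp)⟩
  · exact disjointedRec (fun _ _ ht => ht.diff (measurableSet_openHull _))
      (measurableSet_openHull _)
  · rw [iUnion_disjointed]
    intro p hp
    obtain ⟨S, hS, hpS⟩ := exists_mem_openHull hp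
    refine Set.mem_iUnion.2 ⟨e ⟨S, Finset.mem_powerset.2 hS⟩, ?_⟩
    simpa [B] using hpS

theorem kappa_pos (n : ℕ) : 0 < kappa n := by
  unfold kappa
  have : 0 < Real.Gamma (1 + (n : ℝ) / 2) := Real.Gamma_pos_of_pos (by positivity)
  positivity

theorem IsPolytope.convex (hK : IsPolytope K) : Convex ℝ K := by
  obtain ⟨F, rfl⟩ := hK
  exact convex_convexHull ℝ _

theorem IsPolytope.isCompact (hK : IsPolytope K) : IsCompact K := by
  obtain ⟨F, rfl⟩ := hK
  exact F.finite_toSet.isCompact_convexHull (𝕜 := ℝ)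

variable [Nonempty (USphere d)]

theorem IsPolytope.exists_isSupportMeasures (hK : IsPolytope K) (hne : K.Nonempty) :
    ∃ Λ : Fin d → Measure (Euc d × USphere d), IsSupportMeasures K Λ := by
  have hc := hK.convex
  have hcomp := hK.isCompact
  obtain ⟨N, C, W, hCm, hCd, hcov, hC, hW⟩ : ∃ (N : ℕ) (C : Fin N → Set (Euc d))
      (W : Fin N → Submodule ℝ (Euc d)),
      (∀ i, MeasurableSet (C i)) ∧ Pairwise (Function.onFun Disjoint C) ∧ K ⊆ ⋃ i, C i ∧
      (∀ i, ∀ p ∈ C i, ∀ q ∈ C i, p - q ∈ W i) ∧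
      ∀ i y, IsNormalPair K y → y.1 ∈ C i → (y.2 : Euc d) ∈ (W i)ᗮ := by
    obtain ⟨F, rfl⟩ := hK
    exact exists_face_partition F
  have hDm : ∀ i, MeasurableSet (C i ×ˢ (Set.univ : Set (USphere d))) := fun i =>
    (hCm i).prod MeasurableSet.univ
  have := isFiniteMeasure_parallelMeasure hcomp hne 1
  -- Λ_j collects the pieces with dim W = j. Their parallel volume is a multiple of ε^{d-j}, so its
  -- value at radius 1, divided by κ_{d-j}, is the Steiner coefficient.
  refine ⟨fun j => ∑ i ∈ Finset.univ.filter (fun i => Module.finrank ℝ (W i) = (j : ℕ)),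
    ENNReal.ofReal (1 / kappa (d - (j : ℕ))) •
      (parallelMeasure K 1).restrict (C i ×ˢ Set.univ), fun j => ⟨?_⟩, fun ε hε η hη => ?_⟩
  · rw [Measure.finsetSum_apply]
    refine ENNReal.sum_lt_top.2 fun i _ => ?_
    rw [Measure.smul_apply, smul_eq_mul]
    exact ENNReal.mul_lt_top ENNReal.ofReal_lt_top (measure_lt_top _ _)
  have hsplit : volume (localParallelSet K ε η) =
      ∑ i, volume (localParallelSet K ε (η ∩ C i ×ˢ Set.univ)) := by
    have h1 : localParallelSet K ε η =
        localParallelSet K ε (⋃ i, η ∩ C i ×ˢ (Set.univ : Set (USphere d))) := by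
      ext x
      rw [mem_localParallelSet_iff hc, mem_localParallelSet_iff hc]
      refine exists_congr fun y => ⟨fun ⟨h, h'⟩ => ⟨?_, h'⟩, fun ⟨h, h'⟩ => ⟨?_, h'⟩⟩
      · obtain ⟨i, hi⟩ := Set.mem_iUnion.1 (hcov h'.1.1)
        exact Set.mem_iUnion.2 ⟨i, h, hi, trivial⟩
      · obtain ⟨i, hi, -⟩ := Set.mem_iUnion.1 h
        exact hi
    rw [h1, ← parallelMeasure_apply hcomp hne hc ε
      (MeasurableSet.iUnion fun i => hη.inter (hDm i)), measure_iUnion _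
      fun i => hη.inter (hDm i), tsum_fintype]
    · exact Finset.sum_congr rfl fun i _ =>
        parallelMeasure_apply hcomp hne hc ε (hη.inter (hDm i))
    · intro i j hij
      refine Set.disjoint_left.2 fun y hy hy' => ?_
      exact Set.disjoint_left.1 (hCd hij) hy.2.1 hy'.2.1
  have hpiece : ∀ i, volume (localParallelSet K ε (η ∩ C i ×ˢ Set.univ)) =
      ENNReal.ofReal (ε ^ (d - Module.finrank ℝ (W i))) *
        parallelMeasure K 1 (η ∩ C i ×ˢ Set.univ) := fun i => by
    rw [parallelMeasure_apply hcomp hne hc 1 (hη.inter (hDm i))]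
    exact volume_localParallelSet_eq_pow_mul hc (hC i) (hW i) (fun y hy => hy.2.1) hε
  -- Pieces with dim W = d have no index j, but they carry no unit normals either.
  have htop : ∀ i, d ≤ Module.finrank ℝ (W i) →
      volume (localParallelSet K ε (η ∩ C i ×ˢ Set.univ)) = 0 := fun i hi => by
    have hbot : (W i)ᗮ = ⊥ := by
      rw [Submodule.orthogonal_eq_bot_iff]
      apply Submodule.eq_top_of_finrank_eq
      have := (W i).finrank_le
      simp only [finrank_euclideanSpace, Fintype.card_fin] at this ⊢
      omega
    convert measure_empty (μ := volume)
    refine Set.eq_empty_of_forall_notMem fun x hx => ?_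
    obtain ⟨y, hy, hn, -⟩ := (mem_localParallelSet_iff hc).1 hx
    have h := hW i y hn hy.2.1
    rw [hbot, Submodule.mem_bot] at h
    have h1 := USphere.norm_eq y.2
    rw [h, norm_zero] at h1
    exact zero_ne_one h1
  have hterm : ∀ j : Fin d, ENNReal.ofReal (ε ^ (d - (j : ℕ)) * kappa (d - (j : ℕ))) *
      (∑ i ∈ Finset.univ.filter (fun i => Module.finrank ℝ (W i) = (j : ℕ)),
        ENNReal.ofReal (1 / kappa (d - (j : ℕ))) •
          (parallelMeasure K 1).restrict (C i ×ˢ Set.univ)) η =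
      ∑ i, if Module.finrank ℝ (W i) = (j : ℕ) then
        volume (localParallelSet K ε (η ∩ C i ×ˢ Set.univ)) else 0 := fun j => by
    rw [Measure.finsetSum_apply, Finset.mul_sum, Finset.sum_filter]
    refine Finset.sum_congr rfl fun i _ => ?_
    split_ifs with h
    · rw [hpiece, h, Measure.smul_apply, smul_eq_mul, Measure.restrict_apply hη, ← mul_assoc,
        ← ENNReal.ofReal_mul (mul_nonneg (pow_nonneg hε.le _) (kappa_pos _).le), mul_assoc,
        mul_one_div_cancel (kappa_pos _).ne', mul_one]
    · rfl
  rw [hsplit, Finset.sum_congr rfl fun j _ => hterm j, Finset.sum_comm]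
  refine Finset.sum_congr rfl fun i _ => ?_
  by_cases h : Module.finrank ℝ (W i) < d
  · rw [Finset.sum_eq_single ⟨_, h⟩]
    · simp
    · intro j _ hj
      rw [if_neg fun h' => hj (Fin.ext h'.symm)]
    · simp
  · rw [htop i (not_lt.1 h)]
    simp

end Polytopes

/-! ### Moments of the support measures through parallel volumes -/

section Moments

variable {d : ℕ} {K : Set (Euc d)}

theorem continuous_vecPow (s : ℕ) : Continuous fun u : Euc d => vecPow u s := by
  have h := (ContinuousMultilinearMap.compContinuousLinearMapContinuousMultilinear ℝ
    (fun _ : Fin s => Euc d) (fun _ : Fin s => ℝ) ℝ).cont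
  have h2 : Continuous fun u : Euc d => fun _ : Fin s => innerSL ℝ u :=
    continuous_pi fun _ => (innerSL ℝ).continuous
  exact (h.comp h2).clm_apply
    (continuous_const (y := ContinuousMultilinearMap.mkPiAlgebra ℝ (Fin s) ℝ))

theorem norm_vecPow_le {u : Euc d} (hu : ‖u‖ = 1) (s : ℕ) : ‖vecPow u s‖ ≤ 1 := by
  refine ContinuousMultilinearMap.opNorm_le_bound zero_le_one fun x => ?_
  rw [vecPow_apply, norm_prod, one_mul]
  refine Finset.prod_le_prod (fun _ _ => norm_nonneg _) fun i _ => ?_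
  have := norm_inner_le_norm (𝕜 := ℝ) u (x i)
  rwa [hu, one_mul] at this

theorem integrable_vecPow (μ : Measure (Euc d × USphere d)) [IsFiniteMeasure μ] (s : ℕ) :
    Integrable (fun y => vecPow (y.2 : Euc d) s) μ := by
  have : Continuous fun y : Euc d × USphere d => vecPow (y.2 : Euc d) s :=
    (continuous_vecPow s).comp (continuous_subtype_val.comp continuous_snd)
  exact Integrable.of_bound this.aestronglyMeasurable 1
    (Filter.Eventually.of_forall fun y => norm_vecPow_le (USphere.norm_eq _) s)

theorem integral_vecPow_apply (μ : Measure (Euc d × USphere d)) [IsFiniteMeasure μ] {s : ℕ}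
    (x : Fin s → Euc d) :
    (∫ y, vecPow (y.2 : Euc d) s ∂μ) x = ∫ y, ∏ i, inner ℝ (y.2 : Euc d) (x i) ∂μ := by
  have := (ContinuousMultilinearMap.apply ℝ (fun _ : Fin s => Euc d) ℝ x).integral_comp_comm
    (integrable_vecPow μ s)
  simp only [ContinuousMultilinearMap.apply_apply, vecPow_apply] at this
  exact this.symm

/-- Inversion of a Vandermonde system: Steiner polynomials are determined by their values at
`1, …, d`. -/
theorem exists_steiner_coefficients (k : Fin d) : ∃ a : Fin d → ℝ, ∀ j : Fin d,
    ∑ i, a i * (((i : ℕ) + 1 : ℝ) ^ (d - (j : ℕ)) * kappa (d - (j : ℕ))) =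
      if j = k then 1 else 0 := by
  let A : Matrix (Fin d) (Fin d) ℝ := Matrix.vandermonde fun i : Fin d => ((i : ℕ) + 1 : ℝ)
  have hA : IsUnit A.det := by
    rw [isUnit_iff_ne_zero, Matrix.det_vandermonde_ne_zero_iff]
    intro i j hij
    simpa [Fin.ext_iff] using hij
  have hinv : A⁻¹ * A = 1 := Matrix.nonsing_inv_mul A hA
  -- The exponents d - j run over 1,…,d. Taking out one factor i + 1 leaves d - 1 - j, which is
  -- column `Fin.rev j` of the Vandermonde matrix.
  refine ⟨fun i => A⁻¹ (Fin.rev k) i / (((i : ℕ) + 1) * kappa (d - (k : ℕ))), fun j => ?_⟩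
  have h1 : ∀ i : Fin d, A⁻¹ (Fin.rev k) i / (((i : ℕ) + 1) * kappa (d - (k : ℕ))) *
      (((i : ℕ) + 1 : ℝ) ^ (d - (j : ℕ)) * kappa (d - (j : ℕ))) =
      (A⁻¹ (Fin.rev k) i * A i (Fin.rev j)) * (kappa (d - (j : ℕ)) / kappa (d - (k : ℕ))) :=
    fun i => by
      have h2 : A i (Fin.rev j) = ((i : ℕ) + 1 : ℝ) ^ (d - ((j : ℕ) + 1)) := by
        simp [A, Matrix.vandermonde_apply, Fin.val_rev]
      have h3 : d - (j : ℕ) = d - ((j : ℕ) + 1) + 1 := by omega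
      have h4 : ((i : ℕ) + 1 : ℝ) ≠ 0 := by positivity
      have h5 := (kappa_pos (d - (k : ℕ))).ne'
      rw [h2, show ((i : ℕ) + 1 : ℝ) ^ (d - (j : ℕ)) =
        ((i : ℕ) + 1 : ℝ) ^ (d - ((j : ℕ) + 1)) * ((i : ℕ) + 1) by rw [h3, pow_succ]]
      field_simp
  rw [Finset.sum_congr rfl fun i _ => h1 i, ← Finset.sum_mul, ← Matrix.mul_apply, hinv,
    Matrix.one_apply]
  by_cases h : j = k
  · rw [if_pos h, if_pos (by rw [h]), h, one_mul, div_self (kappa_pos _).ne']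
  · rw [if_neg h, if_neg fun h' => h (Fin.rev_injective h').symm, zero_mul]

theorem IsSupportMeasures.parallelMeasure_eq [Nonempty (USphere d)] (hK : IsCompact K)
    (hne : K.Nonempty) (hc : Convex ℝ K) {Λ : Fin d → Measure (Euc d × USphere d)}
    (hΛ : IsSupportMeasures K Λ) {ε : ℝ} (hε : 0 < ε) :
    parallelMeasure K ε =
      ∑ j : Fin d, ENNReal.ofReal (ε ^ (d - (j : ℕ)) * kappa (d - (j : ℕ))) • Λ j := by
  ext η hη
  rw [parallelMeasure_apply hK hne hc ε hη, hΛ.2 ε hε η hη, Measure.finsetSum_apply]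
  rfl

/-- The right-hand side involves only K, so the choice in `supportMeasure` does not matter for such
integrals. -/
theorem IsSupportMeasures.integral_eq [Nonempty (USphere d)] (hK : IsCompact K)
    (hne : K.Nonempty) (hc : Convex ℝ K) {Λ : Fin d → Measure (Euc d × USphere d)}
    (hΛ : IsSupportMeasures K Λ) {k : Fin d} {a : Fin d → ℝ}
    (ha : ∀ j : Fin d, ∑ i, a i * (((i : ℕ) + 1 : ℝ) ^ (d - (j : ℕ)) * kappa (d - (j : ℕ))) =
      if j = k then 1 else 0) {f : Euc d × USphere d → ℝ} (hf : ∀ j, Integrable f (Λ j)) :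
    ∫ y, f y ∂(Λ k) = ∑ i, a i * ∫ y, f y ∂(parallelMeasure K ((i : ℕ) + 1)) := by
  have h1 : ∀ i : Fin d, ∫ y, f y ∂(parallelMeasure K ((i : ℕ) + 1)) =
      ∑ j : Fin d, (((i : ℕ) + 1 : ℝ) ^ (d - (j : ℕ)) * kappa (d - (j : ℕ))) *
        ∫ y, f y ∂(Λ j) := fun i => by
    rw [hΛ.parallelMeasure_eq hK hne hc (by positivity), integral_finsetSum_measure
      fun j _ => (hf j).smul_measure ENNReal.ofReal_ne_top]
    refine Finset.sum_congr rfl fun j _ => ?_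
    rw [integral_smul_measure, ENNReal.toReal_ofReal, smul_eq_mul]
    have := kappa_pos (d - (j : ℕ))
    positivity
  simp only [h1, Finset.mul_sum]
  rw [Finset.sum_comm]
  have h2 : ∀ j : Fin d, ∑ i : Fin d, a i * (((i : ℕ) + 1 : ℝ) ^ (d - (j : ℕ)) *
      kappa (d - (j : ℕ)) * ∫ y, f y ∂(Λ j)) = (if j = k then 1 else 0) * ∫ y, f y ∂(Λ j) :=
    fun j => by
      rw [← ha j, Finset.sum_mul]
      exact Finset.sum_congr rfl fun i _ => (mul_assoc _ _ _).symm
  simp [h2]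

/-- The derivative of the distance to `K` at `z` in direction `v`, as an upper limit of
difference quotients. -/
def infDistSlope (K : Set (Euc d)) (z v : Euc d) : ℝ :=
  Filter.limsup (fun n : ℕ => ((n : ℝ) + 1) *
    (Metric.infDist (z + ((n : ℝ) + 1)⁻¹ • v) K - Metric.infDist z K)) Filter.atTop

theorem infDistSlope_eq_inner [Nonempty (USphere d)] (hK : IsCompact K) (hne : K.Nonempty)
    (hc : Convex ℝ K) {z : Euc d} (hz : 0 < Metric.infDist z K) (v : Euc d) :
    infDistSlope K z v = inner ℝ ((normalPairAt K z).2 : Euc d) v := by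
  have h := normalPairAt_spec hK hne hc hz
  have ht := inner_normal_eq_of_tendsto h.1 hz v
  rw [← h.2] at ht
  exact ht.limsup_eq

/-- The combination with coefficients `a` of the integrals of `z ↦ ∏ ⟨u(z), x_j⟩`, where `u(z)` is
the gradient of the distance function, over the parallel shells of `K` of width `1, …, d`. -/
def shellMoment (a : Fin d → ℝ) {s : ℕ} (x : Fin s → Euc d) (K : Set (Euc d)) : ℝ :=
  ∑ i, a i * ∫ z in {z | 0 < Metric.infDist z K ∧ Metric.infDist z K ≤ (i : ℕ) + 1},
    ∏ j, infDistSlope K z (x j)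

/-! ### Borel measurability and isometry invariance of the shell moments -/

theorem continuous_infDist_nonemptyCompacts {X : Type*} [TopologicalSpace X]
    {f : X → NonemptyCompacts (Euc d)} {g : X → Euc d} (hf : Continuous f) (hg : Continuous g) :
    Continuous fun p => Metric.infDist (g p) (f p : Set (Euc d)) :=
  Continuous.comp
    (g := fun p : Euc d × NonemptyCompacts (Euc d) => Metric.infDist p.1 (p.2 : Set (Euc d)))
    (f := fun p => (g p, f p)) Metric.lipschitz_infDist.continuous (hg.prodMk hf)

theorem measurable_infDistSlope (v : Euc d) :
    Measurable fun p : NonemptyCompacts (Euc d) × Euc d =>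
      infDistSlope (p.1 : Set (Euc d)) p.2 v := by
  refine Measurable.limsup fun n => Continuous.measurable ?_
  exact continuous_const.mul ((continuous_infDist_nonemptyCompacts continuous_fst
    (continuous_snd.add continuous_const)).sub
      (continuous_infDist_nonemptyCompacts continuous_fst continuous_snd))

theorem measurable_shellMoment (a : Fin d → ℝ) {s : ℕ} (x : Fin s → Euc d) :
    Measurable fun K : NonemptyCompacts (Euc d) => shellMoment a x (K : Set (Euc d)) := by
  refine Finset.measurable_sum _ fun i _ => Measurable.const_mul ?_ _
  have h : Continuous fun p : NonemptyCompacts (Euc d) × Euc d =>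
      Metric.infDist p.2 (p.1 : Set (Euc d)) :=
    continuous_infDist_nonemptyCompacts continuous_fst continuous_snd
  have hs : MeasurableSet {p : NonemptyCompacts (Euc d) × Euc d |
      0 < Metric.infDist p.2 (p.1 : Set (Euc d)) ∧
        Metric.infDist p.2 (p.1 : Set (Euc d)) ≤ (i : ℕ) + 1} :=
    (measurableSet_lt measurable_const h.measurable).inter
      (measurableSet_le h.measurable measurable_const)
  have hm : Measurable fun p : NonemptyCompacts (Euc d) × Euc d =>
      ∏ j, infDistSlope (p.1 : Set (Euc d)) p.2 (x j) :=
    Finset.measurable_prod _ fun j _ => measurable_infDistSlope (x j)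
  have hi := (hm.indicator hs).stronglyMeasurable.integral_prod_right' (ν := volume)
  convert hi.measurable using 2 with K
  rw [← integral_indicator (measurableSet_parallel _ _)]
  rfl

/-- Isometries preserve both the distance function and Lebesgue measure. The translation part is
needed only for the midpoint symmetry in dimension one. -/
theorem shellMoment_image (a : Fin d → ℝ) {s : ℕ} (x : Fin s → Euc d) (K : Set (Euc d))
    (ρ : Euc d ≃ₗᵢ[ℝ] Euc d) (b : Euc d) :
    shellMoment a x ((fun z => ρ z + b) '' K) = shellMoment a (fun j => ρ.symm (x j)) K := by
  have hiso : Isometry fun z => ρ z + b := (isometry_add_right b).comp ρ.isometry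
  have hmp : MeasurePreserving (fun z => ρ z + b) (volume : Measure (Euc d)) volume :=
    (measurePreserving_add_right volume b).comp ρ.measurePreserving
  have hme : MeasurableEmbedding fun z => ρ z + b :=
    (measurableEmbedding_addRight b).comp ρ.toHomeomorph.measurableEmbedding
  unfold shellMoment
  refine Finset.sum_congr rfl fun i _ => ?_
  rw [← hmp.setIntegral_preimage_emb hme]
  have hslope : ∀ z v, infDistSlope ((fun z => ρ z + b) '' K) (ρ z + b) v =
      infDistSlope K z (ρ.symm v) := fun z v => by
    unfold infDistSlope
    congr 1
    ext1 n
    have e : ρ z + b + ((n : ℝ) + 1)⁻¹ • v = ρ (z + ((n : ℝ) + 1)⁻¹ • ρ.symm v) + b := by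
      rw [map_add, map_smul, ρ.apply_symm_apply]; abel
    rw [e]
    have h1 := Metric.infDist_image (t := K) hiso (x := z + ((n : ℝ) + 1)⁻¹ • ρ.symm v)
    have h2 := Metric.infDist_image (t := K) hiso (x := z)
    rw [h1, h2]
  have hinf : ∀ z, Metric.infDist (ρ z + b) ((fun z => ρ z + b) '' K) = Metric.infDist z K :=
    fun z => Metric.infDist_image (t := K) hiso (x := z)
  simp only [Set.preimage_ofPred_eq, hslope, hinf]

/-! ### Minkowski tensors of polytopes as shell moments -/

theorem isSupportMeasures_supportMeasure [Nonempty (USphere d)] (hK : IsPolytope K)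
    (hne : K.Nonempty) : IsSupportMeasures K (supportMeasure K) := by
  have h := hK.exists_isSupportMeasures hne
  have e : supportMeasure K = h.choose := by
    ext1 j
    rw [supportMeasure, dif_pos h]
  rw [e]
  exact h.choose_spec

theorem nonempty_uSphere (k : Fin d) : Nonempty (USphere d) := by
  have : Nontrivial (Euc d) := by
    have : Nonempty (Fin d) := ⟨k⟩
    infer_instance
  exact (NormedSpace.sphere_nonempty.2 zero_le_one).to_subtype

/-- Bridge from the chosen measures to the distance function: invert the Steiner system, pull each
parallel measure back to its shell, and replace the normal by the gradient of the distance. -/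
theorem integral_prod_inner_supportMeasure {k : Fin d} {a : Fin d → ℝ}
    (ha : ∀ j : Fin d, ∑ i, a i * (((i : ℕ) + 1 : ℝ) ^ (d - (j : ℕ)) * kappa (d - (j : ℕ))) =
      if j = k then 1 else 0) (hK : IsPolytope K) (hne : K.Nonempty) {s : ℕ}
    (x : Fin s → Euc d) :
    ∫ y, ∏ j, inner ℝ (y.2 : Euc d) (x j) ∂(supportMeasure K k) = shellMoment a x K := by
  have := nonempty_uSphere k
  have hΛ := isSupportMeasures_supportMeasure hK hne
  have hcont : Continuous fun y : Euc d × USphere d => ∏ j, inner ℝ (y.2 : Euc d) (x j) := by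
    fun_prop
  have hf : ∀ j, Integrable (fun y : Euc d × USphere d => ∏ j, inner ℝ (y.2 : Euc d) (x j))
      (supportMeasure K j) := fun j => by
    have := hΛ.1 j
    have h := (ContinuousMultilinearMap.apply ℝ (fun _ : Fin s => Euc d) ℝ x).integrable_comp
      (integrable_vecPow (supportMeasure K j) s)
    simpa only [ContinuousMultilinearMap.apply_apply, vecPow_apply] using h
  rw [hΛ.integral_eq hK.isCompact hne hK.convex ha hf, shellMoment]
  refine Finset.sum_congr rfl fun i _ => ?_
  congr 1
  rw [parallelMeasure, integral_map
    (measurable_normalPairAt hK.isCompact hne hK.convex).aemeasurable hcont.aestronglyMeasurable]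
  refine setIntegral_congr_fun (measurableSet_parallel _ _) fun z hz => ?_
  exact Finset.prod_congr rfl fun j _ =>
    (infDistSlope_eq_inner hK.isCompact hne hK.convex hz.1 (x j)).symm

theorem isFiniteMeasure_supportMeasure (hK : IsPolytope K) (hne : K.Nonempty) (k : Fin d) :
    IsFiniteMeasure (supportMeasure K k) := by
  have := nonempty_uSphere k
  exact (isSupportMeasures_supportMeasure hK hne).1 k

theorem intrinsicVolume_eq_shellMoment {k : Fin d} {a : Fin d → ℝ}
    (ha : ∀ j : Fin d, ∑ i, a i * (((i : ℕ) + 1 : ℝ) ^ (d - (j : ℕ)) * kappa (d - (j : ℕ))) =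
      if j = k then 1 else 0) (hK : IsPolytope K) (hne : K.Nonempty) :
    intrinsicVolume k K = shellMoment a (fun j : Fin 0 => j.elim0) K := by
  rw [← integral_prod_inner_supportMeasure ha hK hne, intrinsicVolume]
  simp

/-- The normalizing factor of the Minkowski tensor `Φ_k^{0,s}`. -/
def minkowskiFactor (d k s : ℕ) : ℝ :=
  1 / (s.factorial : ℝ) * (omegaConst (d - k) / omegaConst (d - k + s))

theorem minkowskiTensor_apply {k : Fin d} {a : Fin d → ℝ}
    (ha : ∀ j : Fin d, ∑ i, a i * (((i : ℕ) + 1 : ℝ) ^ (d - (j : ℕ)) * kappa (d - (j : ℕ))) =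
      if j = k then 1 else 0) (hK : IsPolytope K) (hne : K.Nonempty) {s : ℕ}
    (x : Fin s → Euc d) :
    minkowskiTensor k s K x = minkowskiFactor d k s * shellMoment a x K := by
  have := isFiniteMeasure_supportMeasure hK hne k
  rw [minkowskiTensor, smul_apply, integral_vecPow_apply,
    integral_prod_inner_supportMeasure ha hK hne, smul_eq_mul, minkowskiFactor]

theorem norm_minkowskiTensor_le (k : Fin d) (s : ℕ) (hK : IsPolytope K) (hne : K.Nonempty) :
    ‖minkowskiTensor k s K‖ ≤ |minkowskiFactor d k s| * intrinsicVolume k K := by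
  have := isFiniteMeasure_supportMeasure hK hne k
  rw [minkowskiTensor, norm_smul, Real.norm_eq_abs]
  refine mul_le_mul_of_nonneg_left ?_ (abs_nonneg _)
  have := norm_integral_le_of_norm_le_const (μ := supportMeasure K k) (C := 1)
    (f := fun y => vecPow (y.2 : Euc d) s)
    (Filter.Eventually.of_forall fun y => norm_vecPow_le (USphere.norm_eq _) s)
  rwa [one_mul] at this

end Moments

/-! ### Measurability and invariance of the expected Minkowski tensors -/

section Expectation

variable {d : ℕ} {Ω : Type*} [MeasurableSpace Ω] {P : Measure Ω}
  {Z : Ω → NonemptyCompacts (Euc d)}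

/-- Expansion in coordinates, used to deduce strong measurability of a tensor-valued map from that
of its evaluations. -/
theorem Tensor.eq_sum_basis {s : ℕ} (T : Tensor d s) :
    T = ∑ r : Fin s → Fin d, T (fun i => EuclideanSpace.basisFun (Fin d) ℝ (r i)) •
      (ContinuousMultilinearMap.mkPiAlgebra ℝ (Fin s) ℝ).compContinuousLinearMap
        (fun i => innerSL ℝ (EuclideanSpace.basisFun (Fin d) ℝ (r i))) := by
  ext x
  have hx : x = fun i => ∑ j, inner ℝ (EuclideanSpace.basisFun (Fin d) ℝ j) (x i) •
      EuclideanSpace.basisFun (Fin d) ℝ j :=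
    funext fun i => ((EuclideanSpace.basisFun (Fin d) ℝ).sum_repr' (x i)).symm
  conv_lhs => rw [hx, ContinuousMultilinearMap.map_sum]
  simp only [ContinuousMultilinearMap.map_smul_univ]
  simp [mul_comm]

theorem aestronglyMeasurable_tensor {s : ℕ} {T : Ω → Tensor d s}
    (h : ∀ x, AEMeasurable (fun ω => T ω x) P) : AEStronglyMeasurable T P := by
  have e : T = fun ω => ∑ r : Fin s → Fin d,
      T ω (fun i => EuclideanSpace.basisFun (Fin d) ℝ (r i)) •
      (ContinuousMultilinearMap.mkPiAlgebra ℝ (Fin s) ℝ).compContinuousLinearMap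
        (fun i => innerSL ℝ (EuclideanSpace.basisFun (Fin d) ℝ (r i))) :=
    funext fun ω => (T ω).eq_sum_basis
  rw [e]
  exact Finset.aestronglyMeasurable_fun_sum _ fun r _ =>
    (h _).aestronglyMeasurable.smul_const _

/-- A finite lower integral says nothing about measurability; that comes from almost sure equality
with a shell moment of order zero. -/
theorem IsIsotropicRandomPolytope.integrable_intrinsicVolume
    (hZ : IsIsotropicRandomPolytope P Z) (k : Fin d)
    (hV : ∫⁻ ω, ENNReal.ofReal (intrinsicVolume k (Z ω : Set (Euc d))) ∂P < ∞) :
    Integrable (fun ω => intrinsicVolume k (Z ω : Set (Euc d))) P := by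
  obtain ⟨a, ha⟩ := exists_steiner_coefficients k
  refine ⟨?_, ?_⟩
  · have hm : Measurable fun ω => shellMoment a (fun j : Fin 0 => j.elim0) (Z ω : Set (Euc d)) :=
      (measurable_shellMoment a _).comp hZ.measurable
    refine hm.aestronglyMeasurable.congr ?_
    filter_upwards [hZ.polytope] with ω hω
    exact (intrinsicVolume_eq_shellMoment ha hω (Z ω).nonempty).symm
  · rw [hasFiniteIntegral_iff_ofReal]
    · exact hV
    · exact Filter.Eventually.of_forall fun ω => measureReal_nonneg

theorem IsIsotropicRandomPolytope.integrable_minkowskiTensor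
    (hZ : IsIsotropicRandomPolytope P Z) (k : Fin d) (s : ℕ)
    (hV : ∫⁻ ω, ENNReal.ofReal (intrinsicVolume k (Z ω : Set (Euc d))) ∂P < ∞) :
    Integrable (fun ω => minkowskiTensor k s (Z ω : Set (Euc d))) P := by
  obtain ⟨a, ha⟩ := exists_steiner_coefficients k
  refine Integrable.mono'
    ((hZ.integrable_intrinsicVolume k hV).const_mul |minkowskiFactor d k s|) ?_ ?_
  · refine aestronglyMeasurable_tensor fun x => ?_
    have hm : Measurable fun ω =>
        minkowskiFactor d k s * shellMoment a x (Z ω : Set (Euc d)) :=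
      ((measurable_shellMoment a x).comp hZ.measurable).const_mul _
    refine hm.aemeasurable.congr ?_
    filter_upwards [hZ.polytope] with ω hω
    exact (minkowskiTensor_apply ha hω (Z ω).nonempty x).symm
  · filter_upwards [hZ.polytope] with ω hω
    exact norm_minkowskiTensor_le k s hω (Z ω).nonempty

theorem IsIsotropicRandomPolytope.integral_minkowskiTensor_apply
    (hZ : IsIsotropicRandomPolytope P Z) {k : Fin d} {s : ℕ}
    (hV : ∫⁻ ω, ENNReal.ofReal (intrinsicVolume k (Z ω : Set (Euc d))) ∂P < ∞)
    {a : Fin d → ℝ}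
    (ha : ∀ j : Fin d, ∑ i, a i * (((i : ℕ) + 1 : ℝ) ^ (d - (j : ℕ)) * kappa (d - (j : ℕ))) =
      if j = k then 1 else 0) (x : Fin s → Euc d) :
    (∫ ω, minkowskiTensor k s (Z ω : Set (Euc d)) ∂P) x =
      ∫ ω, minkowskiFactor d k s * shellMoment a x (Z ω : Set (Euc d)) ∂P := by
  have := (ContinuousMultilinearMap.apply ℝ (fun _ : Fin s => Euc d) ℝ x).integral_comp_comm
    (hZ.integrable_minkowskiTensor k s hV)
  simp only [ContinuousMultilinearMap.apply_apply] at this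
  rw [← this]
  refine integral_congr_ae ?_
  filter_upwards [hZ.polytope] with ω hω
  exact minkowskiTensor_apply ha hω (Z ω).nonempty x

theorem IsIsotropicRandomPolytope.integral_minkowskiTensor_perm
    (hZ : IsIsotropicRandomPolytope P Z) {k : Fin d} {s : ℕ}
    (hV : ∫⁻ ω, ENNReal.ofReal (intrinsicVolume k (Z ω : Set (Euc d))) ∂P < ∞)
    (σ : Equiv.Perm (Fin s)) (x : Fin s → Euc d) :
    (∫ ω, minkowskiTensor k s (Z ω : Set (Euc d)) ∂P) (fun i => x (σ i)) =
      (∫ ω, minkowskiTensor k s (Z ω : Set (Euc d)) ∂P) x := by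
  obtain ⟨a, ha⟩ := exists_steiner_coefficients k
  rw [hZ.integral_minkowskiTensor_apply hV ha, hZ.integral_minkowskiTensor_apply hV ha]
  have h : ∀ K : Set (Euc d), shellMoment a (fun i => x (σ i)) K = shellMoment a x K := fun K => by
    have h0 : ∀ z, ∏ j, infDistSlope K z (x (σ j)) = ∏ j, infDistSlope K z (x j) := fun z =>
      Equiv.prod_comp σ fun j => infDistSlope K z (x j)
    simp only [shellMoment, h0]
  simp only [h]

theorem IsIsotropicRandomPolytope.integral_minkowskiTensor_rotate
    (hZ : IsIsotropicRandomPolytope P Z) {k : Fin d} {s : ℕ}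
    (hV : ∫⁻ ω, ENNReal.ofReal (intrinsicVolume k (Z ω : Set (Euc d))) ∂P < ∞)
    {ρ : Euc d ≃ₗᵢ[ℝ] Euc d} (hρ : LinearMap.det (ρ : Euc d →ₗ[ℝ] Euc d) = 1)
    (x : Fin s → Euc d) :
    (∫ ω, minkowskiTensor k s (Z ω : Set (Euc d)) ∂P) (fun i => ρ (x i)) =
      (∫ ω, minkowskiTensor k s (Z ω : Set (Euc d)) ∂P) x := by
  obtain ⟨a, ha⟩ := exists_steiner_coefficients k
  rw [hZ.integral_minkowskiTensor_apply hV ha, hZ.integral_minkowskiTensor_apply hV ha,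
    integral_const_mul, integral_const_mul]
  -- Equality in distribution is applied to one Borel functional, the shell moment with arguments ρ
  -- x; evaluated at ρ Z it becomes the moment of Z with arguments x.
  have h1 := ((hZ.isotropic ρ hρ).comp (measurable_shellMoment a fun i => ρ (x i))).integral_eq
  have h2 : ∀ K : NonemptyCompacts (Euc d),
      shellMoment a (fun i => ρ (x i)) (rotate ρ K : Set (Euc d)) =
        shellMoment a x (K : Set (Euc d)) := fun K => by
    have h3 := shellMoment_image a (fun i => ρ (x i)) (K : Set (Euc d)) ρ 0
    simp only [add_zero, LinearIsometryEquiv.symm_apply_apply] at h3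
    rw [← h3, rotate, NonemptyCompacts.coe_map]
  simp only [Function.comp_apply, h2] at h1
  rw [h1]

/-- A convex body in dimension one is symmetric about its midpoint. -/
theorem exists_neg_add_image_eq {K : Set (Euc 1)} (hK : IsPolytope K) (hne : K.Nonempty) :
    ∃ b : Euc 1, (fun z => -z + b) '' K = K := by
  have hcont : Continuous fun z : Euc 1 => z 0 := by fun_prop
  have hI := eq_Icc_of_connected_compact
    ((hK.convex.isConnected hne).image _ hcont.continuousOn) (hK.isCompact.image hcont)
  set l := sInf ((fun z : Euc 1 => z 0) '' K)
  set r := sSup ((fun z : Euc 1 => z 0) '' K)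
  have hmem : ∀ z : Euc 1, z ∈ K ↔ l ≤ z 0 ∧ z 0 ≤ r := fun z => by
    rw [← Set.mem_Icc, ← hI]
    refine ⟨fun h => ⟨z, h, rfl⟩, ?_⟩
    rintro ⟨w, hw, hwz⟩
    have : w = z := by
      ext i
      rw [Subsingleton.elim i 0]
      exact hwz
    rwa [← this]
  have hsub : ∀ z ∈ K, -z + WithLp.toLp 2 (fun _ => l + r) ∈ K := fun z hz => by
    rw [hmem] at hz ⊢
    simp only [PiLp.add_apply, PiLp.neg_apply]
    constructor <;> linarith [hz.1, hz.2]
  refine ⟨WithLp.toLp 2 fun _ => l + r, Set.Subset.antisymm ?_ fun z hz => ?_⟩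
  · rintro _ ⟨z, hz, rfl⟩
    exact hsub z hz
  · exact ⟨_, hsub z hz, by simp⟩

theorem IsIsotropicRandomPolytope.integral_minkowskiTensor_neg {Z : Ω → NonemptyCompacts (Euc 1)}
    (hZ : IsIsotropicRandomPolytope P Z) {k : Fin 1} {s : ℕ}
    (hV : ∫⁻ ω, ENNReal.ofReal (intrinsicVolume k (Z ω : Set (Euc 1))) ∂P < ∞)
    (x : Fin s → Euc 1) :
    (∫ ω, minkowskiTensor k s (Z ω : Set (Euc 1)) ∂P) (fun i => -x i) =
      (∫ ω, minkowskiTensor k s (Z ω : Set (Euc 1)) ∂P) x := by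
  obtain ⟨a, ha⟩ := exists_steiner_coefficients k
  rw [hZ.integral_minkowskiTensor_apply hV ha, hZ.integral_minkowskiTensor_apply hV ha]
  refine integral_congr_ae ?_
  filter_upwards [hZ.polytope] with ω hω
  obtain ⟨b, hb⟩ := exists_neg_add_image_eq hω (Z ω).nonempty
  have h := shellMoment_image a x (Z ω : Set (Euc 1)) (LinearIsometryEquiv.neg ℝ) b
  simp only [LinearIsometryEquiv.coe_neg, LinearIsometryEquiv.symm_neg, hb] at h
  rw [h]

end Expectation

/-! ### Isotropic symmetric tensors -/

section IsotropicTensors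

variable {d : ℕ}

/-- The reflection exchanging x and y has determinant -1. Composing it with the reflection in the
hyperplane orthogonal to some w ≠ 0 with w ⟂ y keeps y fixed and corrects the sign; such a w exists
because d ≥ 2. -/
theorem exists_rotation_apply_eq (hd : 2 ≤ d) {x y : Euc d} (hxy : ‖x‖ = ‖y‖) :
    ∃ ρ : Euc d ≃ₗᵢ[ℝ] Euc d, LinearMap.det (ρ : Euc d →ₗ[ℝ] Euc d) = 1 ∧ ρ x = y := by
  by_cases h : x = y
  · exact ⟨LinearIsometryEquiv.refl ℝ _, LinearMap.det_id, h⟩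
  obtain ⟨w, hw, hw0⟩ : ∃ w ∈ (ℝ ∙ y)ᗮ, w ≠ 0 := by
    apply Submodule.exists_mem_ne_zero_of_ne_bot
    rw [Ne, Submodule.orthogonal_eq_bot_iff]
    intro htop
    have h1 := finrank_span_le_card (R := ℝ) ({y} : Set (Euc d))
    rw [htop, finrank_top, finrank_euclideanSpace, Fintype.card_fin, Set.toFinset_singleton,
      Finset.card_singleton] at h1
    omega
  have hdet : ∀ v : Euc d, v ≠ 0 →
      LinearMap.det ((ℝ ∙ v)ᗮ.reflection : Euc d →ₗ[ℝ] Euc d) = -1 := fun v hv => by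
    have h1 := (ℝ ∙ v)ᗮ.det_reflection
    rw [Submodule.orthogonal_orthogonal, finrank_span_singleton hv, pow_one] at h1
    exact h1
  refine ⟨(ℝ ∙ (x - y))ᗮ.reflection.trans (ℝ ∙ w)ᗮ.reflection, ?_, ?_⟩
  · have e : (((ℝ ∙ (x - y))ᗮ.reflection.trans (ℝ ∙ w)ᗮ.reflection : Euc d ≃ₗᵢ[ℝ] Euc d) :
        Euc d →ₗ[ℝ] Euc d) = ((ℝ ∙ w)ᗮ.reflection : Euc d →ₗ[ℝ] Euc d) ∘ₗ
          ((ℝ ∙ (x - y))ᗮ.reflection : Euc d →ₗ[ℝ] Euc d) := rfl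
    rw [e, LinearMap.det_comp, hdet w hw0, hdet _ (sub_ne_zero.2 h)]
    norm_num
  · rw [LinearIsometryEquiv.trans_apply, Submodule.reflection_sub hxy]
    rw [Submodule.reflection_eq_self_iff, Submodule.mem_orthogonal_singleton_iff_inner_right]
    rw [Submodule.mem_orthogonal_singleton_iff_inner_right] at hw
    rw [real_inner_comm, hw]

theorem Tensor.diagonal_smul {s : ℕ} (T : Tensor d s) (t : ℝ) (x : Euc d) :
    T (fun _ => t • x) = t ^ s * T fun _ => x := by
  have := T.map_smul_univ (fun _ => t) fun _ => x
  simpa using this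

theorem Tensor.diagonal_eq_const_mul_norm_pow {s : ℕ} {T : Tensor d s} {x₀ : Euc d}
    (hx₀ : ‖x₀‖ = 1) (h : ∀ x y : Euc d, ‖x‖ = 1 → ‖y‖ = 1 → T (fun _ => x) = T fun _ => y)
    (x : Euc d) : T (fun _ => x) = T (fun _ => x₀) * ‖x‖ ^ s := by
  by_cases hx : x = 0
  · rw [hx, norm_zero, mul_comm, ← Tensor.diagonal_smul, zero_smul]
  · have hx' : ‖x‖ ≠ 0 := norm_ne_zero_iff.2 hx
    have h1 : ‖‖x‖⁻¹ • x‖ = 1 := by rw [norm_smul, norm_inv, norm_norm, inv_mul_cancel₀ hx']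
    rw [mul_comm, ← h _ _ h1 hx₀, ← Tensor.diagonal_smul, smul_inv_smul₀ hx']

/-- A symmetric tensor is determined by its diagonal. -/
theorem Tensor.ext_of_diagonal {s : ℕ} {S T : Tensor d s}
    (hS : ∀ (σ : Equiv.Perm (Fin s)) x, S (fun i => x (σ i)) = S x)
    (hT : ∀ (σ : Equiv.Perm (Fin s)) x, T (fun i => x (σ i)) = T x)
    (h : ∀ x : Euc d, S (fun _ => x) = T fun _ => x) : S = T := by
  ext v
  -- Polarization by differentiation: the s-th derivative at 0 of the diagonal is the sum over all
  -- permutations, which for a symmetric tensor is s! times the tensor.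
  have h1 := S.iteratedFDeriv_comp_diagonal 0 v
  have h2 := T.iteratedFDeriv_comp_diagonal 0 v
  have h3 : (fun x : Euc d => S fun _ => x) = fun x => T fun _ => x := funext h
  rw [h3, h2] at h1
  simp only [hS, hT, Finset.sum_const, nsmul_eq_mul] at h1
  have h4 : ((Finset.univ : Finset (Equiv.Perm (Fin s))).card : ℝ) ≠ 0 := by
    simp [Fintype.card_perm, Nat.factorial_ne_zero]
  exact (mul_left_cancel₀ h4 h1).symm

theorem symPow_perm {r : ℕ} (a : Tensor d r) (m : ℕ) (σ : Equiv.Perm (Fin (m * r)))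
    (x : Fin (m * r) → Euc d) : symPow a m (fun i => x (σ i)) = symPow a m x := by
  rw [symPow_apply, symPow_apply]
  congr 1
  exact Equiv.sum_comp (Equiv.mulLeft σ) fun τ : Equiv.Perm (Fin (m * r)) =>
    ∏ i : Fin m, a fun j => x (τ (finProdFinEquiv (i, j)))

theorem symPow_metricTensor_diagonal (m : ℕ) (x : Euc d) :
    symPow (metricTensor d) m (fun _ => x) = ‖x‖ ^ (m * 2) := by
  rw [symPow_apply]
  simp only [metricTensor_apply, Finset.prod_const, Finset.sum_const, Finset.card_univ,
    Fintype.card_perm, Fintype.card_fin, nsmul_eq_mul, real_inner_self_eq_norm_sq]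
  have : ((m * 2).factorial : ℝ) ≠ 0 := by exact_mod_cast Nat.factorial_ne_zero _
  field_simp
  rw [← pow_mul, mul_comm]

theorem Tensor.cast_apply {p q : ℕ} (h : p = q) (T : Tensor d p) (x : Fin q → Euc d) :
    Tensor.cast h T x = T fun i => x (Fin.cast h i) := rfl

theorem Tensor.cast_perm {p q : ℕ} (h : p = q) {T : Tensor d p}
    (hT : ∀ (σ : Equiv.Perm (Fin p)) x, T (fun i => x (σ i)) = T x) (σ : Equiv.Perm (Fin q))
    (x : Fin q → Euc d) : Tensor.cast h T (fun i => x (σ i)) = Tensor.cast h T x := by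
  subst h
  exact hT σ x

end IsotropicTensors

/-! ### Gaussian moments -/

section Gauss

variable {d : ℕ}

theorem omegaConst_eq {n : ℕ} (hn : n ≠ 0) :
    omegaConst n = 2 * Real.pi ^ ((n : ℝ) / 2) / Real.Gamma ((n : ℝ) / 2) := by
  have hn' : (n : ℝ) / 2 ≠ 0 := by positivity
  have h0 : (n : ℝ) ≠ 0 := by exact_mod_cast hn
  have hG : Real.Gamma ((n : ℝ) / 2) ≠ 0 := (Real.Gamma_pos_of_pos (by positivity)).ne'
  rw [omegaConst, kappa, add_comm, Real.Gamma_add_one hn']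
  field_simp

theorem omegaConst_pos {n : ℕ} (hn : n ≠ 0) : 0 < omegaConst n :=
  mul_pos (by positivity) (kappa_pos n)

theorem integrableOn_pow_mul_exp_neg_sq (n : ℕ) :
    IntegrableOn (fun t : ℝ => t ^ n * Real.exp (-t ^ 2)) (Set.Ioi 0) := by
  have h := integrableOn_rpow_mul_exp_neg_rpow (p := 2) (s := n)
    (lt_of_lt_of_le neg_one_lt_zero n.cast_nonneg) two_pos
  simpa [Real.rpow_natCast, Real.rpow_ofNat] using h

theorem integral_Ioi_pow_mul_exp_neg_sq (n : ℕ) :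
    ∫ t in Set.Ioi (0 : ℝ), t ^ n * Real.exp (-t ^ 2) = Real.Gamma (((n : ℝ) + 1) / 2) / 2 := by
  have h := integral_rpow_mul_exp_neg_rpow (p := 2) (q := n) two_pos
    (lt_of_lt_of_le neg_one_lt_zero n.cast_nonneg)
  simp only [Real.rpow_natCast, Real.rpow_ofNat] at h
  rw [h]; ring

theorem integral_pow_mul_exp_neg_sq {n : ℕ} (hn : Even n) :
    ∫ t : ℝ, t ^ n * Real.exp (-t ^ 2) = Real.Gamma (((n : ℝ) + 1) / 2) := by
  have h := integral_comp_abs (f := fun t : ℝ => t ^ n * Real.exp (-t ^ 2))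
  simp only [hn.pow_abs, sq_abs] at h
  rw [h, integral_Ioi_pow_mul_exp_neg_sq]; ring

theorem integrable_norm_pow_mul_exp (hd : 1 ≤ d) (s : ℕ) :
    Integrable fun x : Euc d => ‖x‖ ^ s * Real.exp (-‖x‖ ^ 2) := by
  have : Nontrivial (Euc d) := by
    have : Nonempty (Fin d) := ⟨⟨0, hd⟩⟩
    infer_instance
  rw [integrable_fun_norm_addHaar volume (f := fun t : ℝ => t ^ s * Real.exp (-t ^ 2))]
  refine (integrableOn_pow_mul_exp_neg_sq (d - 1 + s)).congr_fun (fun t _ => ?_) measurableSet_Ioi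
  simp [pow_add, mul_assoc]

theorem integral_norm_pow_mul_exp (hd : 1 ≤ d) (s : ℕ) :
    ∫ x : Euc d, ‖x‖ ^ s * Real.exp (-‖x‖ ^ 2) =
      omegaConst d * (Real.Gamma (((d : ℝ) + s) / 2) / 2) := by
  have hne : Nonempty (Fin d) := ⟨⟨0, hd⟩⟩
  have : Nontrivial (Euc d) := inferInstance
  rw [integral_fun_norm_addHaar volume fun t : ℝ => t ^ s * Real.exp (-t ^ 2)]
  have h1 : ∫ t in Set.Ioi (0 : ℝ), t ^ (Module.finrank ℝ (Euc d) - 1) •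
      (t ^ s * Real.exp (-t ^ 2)) = Real.Gamma (((d : ℝ) + s) / 2) / 2 := by
    have h2 := integral_Ioi_pow_mul_exp_neg_sq (d - 1 + s)
    have h3 : (((d - 1 + s : ℕ) : ℝ) + 1) = (d : ℝ) + s := by
      push_cast [Nat.cast_sub hd]; ring
    rw [h3] at h2
    rw [← h2]
    simp [pow_add, mul_assoc]
  have h4 : (volume : Measure (Euc d)).real (Metric.ball 0 1) = kappa d := by
    rw [Measure.real, EuclideanSpace.volume_ball, kappa, Fintype.card_fin, add_comm]
    rw [ENNReal.ofReal_one, one_pow, one_mul, ENNReal.toReal_ofReal, Real.sqrt_eq_rpow,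
      ← Real.rpow_natCast, ← Real.rpow_mul Real.pi_pos.le]
    · congr 2; ring
    · have : 0 < Real.Gamma ((d : ℝ) / 2 + 1) := Real.Gamma_pos_of_pos (by positivity)
      positivity
  rw [h1, h4, finrank_euclideanSpace, Fintype.card_fin, omegaConst, nsmul_eq_mul, smul_eq_mul,
    mul_assoc]

theorem integral_coord_pow_mul_exp (i₀ : Fin d) {s : ℕ} (hs : Even s) :
    ∫ x : Euc d, x i₀ ^ s * Real.exp (-‖x‖ ^ 2) =
      Real.Gamma (((s : ℝ) + 1) / 2) * √Real.pi ^ (d - 1) := by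
  have h1 : ∀ x : Euc d, x i₀ ^ s * Real.exp (-‖x‖ ^ 2) =
      ∏ i, (if i = i₀ then x i ^ s else 1) * Real.exp (-x i ^ 2) := fun x => by
    rw [Finset.prod_mul_distrib, Finset.prod_ite_eq' Finset.univ i₀ fun i => x i ^ s,
      if_pos (Finset.mem_univ _), ← Real.exp_sum, EuclideanSpace.real_norm_sq_eq,
      Finset.sum_neg_distrib]
  simp only [h1]
  have h2 := (EuclideanSpace.volume_preserving_symm_measurableEquiv_toLp (Fin d)).symm
  have h3 := h2.integral_comp' (g := fun x : Euc d =>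
    ∏ i, (if i = i₀ then x i ^ s else 1) * Real.exp (-x i ^ 2))
  rw [← h3]
  have h4 := integral_fintype_prod_volume_eq_prod (𝕜 := ℝ) (ι := Fin d)
    (f := fun i (t : ℝ) => (if i = i₀ then t ^ s else 1) * Real.exp (-t ^ 2))
  refine h4.trans ?_
  rw [← Finset.mul_prod_erase Finset.univ _ (Finset.mem_univ i₀)]
  congr 1
  · simp only [if_true]
    exact integral_pow_mul_exp_neg_sq hs
  · rw [Finset.prod_congr rfl (g := fun _ => √Real.pi)]
    · rw [Finset.prod_const, Finset.card_erase_of_mem (Finset.mem_univ _), Finset.card_univ,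
        Fintype.card_fin]
    · intro i hi
      have h5 := integral_gaussian 1
      simp only [neg_mul, one_mul, div_one] at h5
      simp [Finset.ne_of_mem_erase hi, h5]

/-- Rotational symmetry of the Gaussian weight: a reflection taking u to a coordinate vector reduces
to the product integral. Independence of u is what turns moments of Λ_k into its total mass. -/
theorem integral_inner_pow_mul_exp (hd : 1 ≤ d) {s : ℕ} (hs : Even s) {u : Euc d}
    (hu : ‖u‖ = 1) : ∫ x : Euc d, inner ℝ u x ^ s * Real.exp (-‖x‖ ^ 2) =
      Real.Gamma (((s : ℝ) + 1) / 2) * √Real.pi ^ (d - 1) := by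
  let i₀ : Fin d := ⟨0, hd⟩
  let e : Euc d := EuclideanSpace.single i₀ 1
  have he : ‖u‖ = ‖e‖ := by simp [e, hu]
  let ρ := (ℝ ∙ (u - e))ᗮ.reflection
  have hρ : ρ u = e := Submodule.reflection_sub he
  rw [← integral_coord_pow_mul_exp i₀ hs,
    ← ρ.measurePreserving.integral_comp' (f := ρ.toMeasurableEquiv)
      (g := fun x : Euc d => x i₀ ^ s * Real.exp (-‖x‖ ^ 2))]
  refine integral_congr_ae (Filter.Eventually.of_forall fun x => ?_)
  have h1 : (ρ x) i₀ = inner ℝ u x := by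
    rw [← ρ.inner_map_map u x, hρ]
    simp [e, EuclideanSpace.inner_single_left]
  change inner ℝ u x ^ s * Real.exp (-‖x‖ ^ 2) = (ρ x) i₀ ^ s * Real.exp (-‖ρ x‖ ^ 2)
  rw [h1, ρ.norm_map]

theorem integrable_diagonal_mul_exp (hd : 1 ≤ d) {s : ℕ} (T : Tensor d s) :
    Integrable fun x : Euc d => T (fun _ => x) * Real.exp (-‖x‖ ^ 2) := by
  refine ((integrable_norm_pow_mul_exp hd s).const_mul ‖T‖).mono' ?_
    (Filter.Eventually.of_forall fun x => ?_)
  · have : Continuous fun x : Euc d => T fun _ => x :=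
      T.cont.comp (continuous_pi fun _ => continuous_id)
    exact (this.mul (by fun_prop)).aestronglyMeasurable
  · have h := T.le_opNorm fun _ => x
    rw [Finset.prod_const, Finset.card_univ, Fintype.card_fin] at h
    rw [norm_mul, Real.norm_of_nonneg (Real.exp_pos _).le, ← mul_assoc]
    exact mul_le_mul_of_nonneg_right h (Real.exp_pos _).le

/-- The Gaussian integral of the diagonal of a tensor. -/
def gaussDiagonal (hd : 1 ≤ d) (s : ℕ) : Tensor d s →L[ℝ] ℝ :=
  LinearMap.mkContinuous
    { toFun := fun T => ∫ x : Euc d, T (fun _ => x) * Real.exp (-‖x‖ ^ 2)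
      map_add' := fun S T => by
        rw [← integral_add (integrable_diagonal_mul_exp hd S) (integrable_diagonal_mul_exp hd T)]
        simp only [add_apply, add_mul]
      map_smul' := fun c T => by
        rw [RingHom.id_apply, smul_eq_mul, ← integral_const_mul]
        simp only [smul_apply, smul_eq_mul, mul_assoc] }
    (∫ x : Euc d, ‖x‖ ^ s * Real.exp (-‖x‖ ^ 2)) fun T => by
      rw [mul_comm, ← integral_const_mul]
      refine norm_integral_le_of_norm_le ((integrable_norm_pow_mul_exp hd s).const_mul ‖T‖)
        (Filter.Eventually.of_forall fun x => ?_)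
      have h := T.le_opNorm fun _ => x
      rw [Finset.prod_const, Finset.card_univ, Fintype.card_fin] at h
      rw [norm_mul, Real.norm_of_nonneg (Real.exp_pos _).le, ← mul_assoc]
      exact mul_le_mul_of_nonneg_right h (Real.exp_pos _).le

theorem gaussDiagonal_apply (hd : 1 ≤ d) {s : ℕ} (T : Tensor d s) :
    gaussDiagonal hd s T = ∫ x : Euc d, T (fun _ => x) * Real.exp (-‖x‖ ^ 2) := rfl

theorem gaussDiagonal_vecPow (hd : 1 ≤ d) {s : ℕ} (hs : Even s) {u : Euc d} (hu : ‖u‖ = 1) :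
    gaussDiagonal hd s (vecPow u s) = Real.Gamma (((s : ℝ) + 1) / 2) * √Real.pi ^ (d - 1) := by
  rw [gaussDiagonal_apply, ← integral_inner_pow_mul_exp hd hs hu]
  simp [vecPow_apply]

theorem gaussDiagonal_of_diagonal (hd : 1 ≤ d) {s : ℕ} {T : Tensor d s} {c : ℝ}
    (hT : ∀ x, T (fun _ => x) = c * ‖x‖ ^ s) :
    gaussDiagonal hd s T = c * (omegaConst d * (Real.Gamma (((d : ℝ) + s) / 2) / 2)) := by
  rw [gaussDiagonal_apply, ← integral_norm_pow_mul_exp hd, ← integral_const_mul]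
  simp only [hT, mul_assoc]

theorem gaussDiagonal_minkowskiTensor (hd : 1 ≤ d) {K : Set (Euc d)} (k : Fin d) {s : ℕ}
    (hs : Even s) (hK : IsPolytope K) (hne : K.Nonempty) :
    gaussDiagonal hd s (minkowskiTensor k s K) =
      minkowskiFactor d k s * (Real.Gamma (((s : ℝ) + 1) / 2) * √Real.pi ^ (d - 1)) *
        intrinsicVolume k K := by
  have := isFiniteMeasure_supportMeasure hK hne k
  rw [minkowskiTensor, map_smul,
    ← (gaussDiagonal hd s).integral_comp_comm (integrable_vecPow _ s)]
  simp only [gaussDiagonal_vecPow hd hs (USphere.norm_eq _)]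
  rw [integral_const, intrinsicVolume, minkowskiFactor]
  simp only [smul_eq_mul]
  ring

end Gauss

/-! ### The expected Minkowski tensors of isotropic random polytopes -/

section Main

variable {d : ℕ} {Ω : Type*} [MeasurableSpace Ω] {P : Measure Ω}
  {Z : Ω → NonemptyCompacts (Euc d)}

theorem IsIsotropicRandomPolytope.integral_minkowskiTensor_diagonal_eq
    (hZ : IsIsotropicRandomPolytope P Z) {k : Fin d} {s : ℕ}
    (hV : ∫⁻ ω, ENNReal.ofReal (intrinsicVolume k (Z ω : Set (Euc d))) ∂P < ∞)
    {x y : Euc d} (hxy : ‖x‖ = ‖y‖) :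
    (∫ ω, minkowskiTensor k s (Z ω : Set (Euc d)) ∂P) (fun _ => x) =
      (∫ ω, minkowskiTensor k s (Z ω : Set (Euc d)) ∂P) fun _ => y := by
  by_cases hd : 2 ≤ d
  · obtain ⟨ρ, hρ, rfl⟩ := exists_rotation_apply_eq hd hxy
    exact (hZ.integral_minkowskiTensor_rotate hV hρ fun _ => x).symm
  · obtain rfl : d = 1 := by have := k.pos; omega
    have h : x 0 = y 0 ∨ x 0 = -y 0 := by
      rw [EuclideanSpace.norm_eq, EuclideanSpace.norm_eq] at hxy
      simpa [Real.sqrt_sq_eq_abs, abs_eq_abs] using hxy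
    rcases h with h | h
    · have : x = y := by ext i; rw [Subsingleton.elim i 0, h]
      rw [this]
    · have : x = -y := by ext i; rw [Subsingleton.elim i 0, h, PiLp.neg_apply]
      rw [this]
      exact hZ.integral_minkowskiTensor_neg hV fun _ => y

/-- By ω_n Γ(n/2) = 2 π^{n/2}, both sides of the key identity `h1` equal 2 π^{(d+s)/2}; the rest is
cancellation. -/
theorem minkowskiFactor_mul_gauss (hd : 1 ≤ d) (k s : ℕ) :
    minkowskiFactor d k s * (Real.Gamma (((s : ℝ) + 1) / 2) * √Real.pi ^ (d - 1)) =
      (2 * omegaConst (d + s) * omegaConst (d - k) /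
        (s.factorial * omegaConst d * omegaConst (s + 1) * omegaConst (d - k + s))) *
        (omegaConst d * (Real.Gamma (((d : ℝ) + s) / 2) / 2)) := by
  have hω := (omegaConst_pos (n := d) (by omega)).ne'
  have hG : Real.Gamma (((d : ℝ) + s) / 2) ≠ 0 := (Real.Gamma_pos_of_pos (by positivity)).ne'
  have hG' : Real.Gamma (((s : ℝ) + 1) / 2) ≠ 0 := (Real.Gamma_pos_of_pos (by positivity)).ne'
  have h1 : omegaConst (d + s) * Real.Gamma (((d : ℝ) + s) / 2) =
      omegaConst (s + 1) * (Real.Gamma (((s : ℝ) + 1) / 2) * √Real.pi ^ (d - 1)) := by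
    rw [omegaConst_eq (by omega), omegaConst_eq (by omega)]
    push_cast
    have h2 : Real.pi ^ (((d : ℝ) + s) / 2) =
        Real.pi ^ (((s : ℝ) + 1) / 2) * √Real.pi ^ (d - 1) := by
      rw [Real.sqrt_eq_rpow, ← Real.rpow_natCast, ← Real.rpow_mul Real.pi_pos.le,
        ← Real.rpow_add Real.pi_pos]
      congr 1
      push_cast [Nat.cast_sub hd]
      ring
    rw [h2]
    field_simp
  have hω' := (omegaConst_pos (n := s + 1) (by omega)).ne'
  have hs : (s.factorial : ℝ) ≠ 0 := by exact_mod_cast s.factorial_ne_zero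
  have h3 : √Real.pi ^ (d - 1) * Real.Gamma (((s : ℝ) + 1) / 2) =
      omegaConst (d + s) * Real.Gamma (((d : ℝ) + s) / 2) / omegaConst (s + 1) := by
    rw [h1]; field_simp
  rw [mul_comm (Real.Gamma (((s : ℝ) + 1) / 2)), h3, minkowskiFactor]
  field_simp

theorem IsIsotropicRandomPolytope.integral_minkowskiTensor
    (hZ : IsIsotropicRandomPolytope P Z) (k : Fin d) (s : ℕ)
    (hV : ∫⁻ ω, ENNReal.ofReal (intrinsicVolume k (Z ω : Set (Euc d))) ∂P < ∞) :
    ∫ ω, minkowskiTensor k s (Z ω : Set (Euc d)) ∂P =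
      if h : Even s then
        (2 * omegaConst (d + s) * omegaConst (d - (k : ℕ)) /
            (s.factorial * omegaConst d * omegaConst (s + 1) * omegaConst (d - (k : ℕ) + s)) *
          ∫ ω, intrinsicVolume k (Z ω : Set (Euc d)) ∂P) •
          Tensor.cast (Nat.div_two_mul_two_of_even h) (symPow (metricTensor d) (s / 2))
      else 0 := by
  have hd : 1 ≤ d := k.pos
  obtain ⟨u₀⟩ := nonempty_uSphere k
  have hdiag := Tensor.diagonal_eq_const_mul_norm_pow (USphere.norm_eq u₀)
    fun x y hx hy => hZ.integral_minkowskiTensor_diagonal_eq (s := s) hV (hx.trans hy.symm)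
  set T := ∫ ω, minkowskiTensor k s (Z ω : Set (Euc d)) ∂P with hT
  have hperm : ∀ (σ : Equiv.Perm (Fin s)) x, T (fun i => x (σ i)) = T x :=
    fun σ x => hZ.integral_minkowskiTensor_perm hV σ x
  split_ifs with h
  · refine Tensor.ext_of_diagonal hperm (fun σ x => ?_) fun x => ?_
    · rw [smul_apply, smul_apply, Tensor.cast_perm _ (symPow_perm _ _)]
    · rw [hdiag, smul_apply, Tensor.cast_apply, symPow_metricTensor_diagonal,
        Nat.div_two_mul_two_of_even h, smul_eq_mul]
      congr 1
      -- The Gaussian functional of T is computed twice: from the diagonal c‖x‖^s, and under the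
      -- expectation, where it yields a multiple of the mean of V_k.
      have h1 := gaussDiagonal_of_diagonal hd hdiag
      rw [hT, ← (gaussDiagonal hd s).integral_comp_comm (hZ.integrable_minkowskiTensor k s hV),
        ← hT] at h1
      have h2 : ∫ ω, gaussDiagonal hd s (minkowskiTensor k s (Z ω : Set (Euc d))) ∂P =
          minkowskiFactor d k s * (Real.Gamma (((s : ℝ) + 1) / 2) * √Real.pi ^ (d - 1)) *
            ∫ ω, intrinsicVolume k (Z ω : Set (Euc d)) ∂P := by
        rw [← integral_const_mul]
        refine integral_congr_ae ?_
        filter_upwards [hZ.polytope] with ω hω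
        exact gaussDiagonal_minkowskiTensor hd k h hω (Z ω).nonempty
      have h3 : omegaConst d * (Real.Gamma (((d : ℝ) + s) / 2) / 2) ≠ 0 :=
        (mul_pos (omegaConst_pos (by omega))
          (half_pos (Real.Gamma_pos_of_pos (by positivity)))).ne'
      rw [h2, minkowskiFactor_mul_gauss hd] at h1
      refine mul_right_cancel₀ h3 ?_
      rw [← h1]
      ring
  · refine Tensor.ext_of_diagonal hperm (fun _ _ => rfl) fun x => ?_
    -- For odd s the diagonal is both even, by invariance, and odd, by homogeneity.
    have h1 := hZ.integral_minkowskiTensor_diagonal_eq (s := s) hV (norm_neg x)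
    have h2 := T.diagonal_smul (-1) x
    rw [(Nat.not_even_iff_odd.1 h).neg_one_pow] at h2
    simp only [neg_smul, one_smul, neg_mul, one_mul] at h2
    rw [← hT] at h1
    rw [zero_apply]
    linarith

end Main

end

/-! ### The expectation formula and its specialization to surface tensors -/

theorem lemma5p1 {d : ℕ} {Ω : Type*} [MeasurableSpace Ω] (P : Measure Ω) [IsProbabilityMeasure P]
    (Z : Ω → NonemptyCompacts (Euc d)) (hZ : IsIsotropicRandomPolytope P Z) (s : ℕ) :
    (∀ k : Fin d,
      (∫⁻ ω, ENNReal.ofReal (intrinsicVolume k (Z ω : Set (Euc d))) ∂P) < ∞ →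
        Integrable (fun ω => intrinsicVolume k (Z ω : Set (Euc d))) P ∧
        Integrable (fun ω => minkowskiTensor k s (Z ω : Set (Euc d))) P ∧
        ∫ ω, minkowskiTensor k s (Z ω : Set (Euc d)) ∂P =
          if h : Even s then
            (2 * omegaConst (d + s) * omegaConst (d - (k : ℕ)) /
                (s.factorial * omegaConst d * omegaConst (s + 1) *
                  omegaConst (d - (k : ℕ) + s)) *
              ∫ ω, intrinsicVolume k (Z ω : Set (Euc d)) ∂P) •
              Tensor.cast (Nat.div_two_mul_two_of_even h) (symPow (metricTensor d) (s / 2))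
          else 0) ∧
    (∀ k : Fin d, (k : ℕ) = d - 1 →
      (∫⁻ ω, ENNReal.ofReal (intrinsicVolume k (Z ω : Set (Euc d))) ∂P) < ∞ →
        ∫ ω, minkowskiTensor k s (Z ω : Set (Euc d)) ∂P =
          if h : Even s then
            (4 * omegaConst (d + s) /
                (s.factorial * omegaConst d * omegaConst (s + 1) ^ 2) *
              ∫ ω, intrinsicVolume k (Z ω : Set (Euc d)) ∂P) •
              Tensor.cast (Nat.div_two_mul_two_of_even h) (symPow (metricTensor d) (s / 2))
          else 0) := by
  refine ⟨fun k hV => ⟨hZ.integrable_intrinsicVolume k hV, hZ.integrable_minkowskiTensor k s hV,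
    hZ.integral_minkowskiTensor k s hV⟩, fun k hk hV => ?_⟩
  have h1 : d - (k : ℕ) = 1 := by have := k.pos; omega
  -- For k = d - 1 one has ω_{d-k} = ω_1 = 2 and ω_{d-k+s} = ω_{s+1}, which gives the factor 4 and
  -- the square.
  have hω : omegaConst 1 = 2 := by
    have hπ : Real.pi ^ ((1 : ℝ) / 2) ≠ 0 := by positivity
    rw [omegaConst_eq one_ne_zero, Nat.cast_one, Real.Gamma_one_half_eq, Real.sqrt_eq_rpow,
      mul_div_assoc, div_self hπ, mul_one]
  rw [hZ.integral_minkowskiTensor k s hV, h1, hω, add_comm 1 s]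
  congr! 4 <;> ring
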